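/- An \emph{infinite time Turing machine} has three one-way infinite tapes (input, scratch, output) with cells indexed by $\mathbb N$ and containing $0$ or $1$, and one head, which reads and writes the three cells at its position simultaneously. A program has a finite set of states, with three distinct special states \emph{start}, \emph{limit} and \emph{halt}, and an instruction for every state and every triple of bits under the head: it prescribes the three bits to write, a movement of the head (one cell left, one cell right, or none; a head on the left-most cell that is told to move left stays there) and the next state. On input $x\in 2^{\omega}$, at stage $0$ the input tape contains $x$, the other tapes contain only $0$s, and the head is on the left-most cell in the start state. The configuration at stage $\alpha+1$ results from that at stage $\alpha$ by carrying out one instruction. At a limit stage $\lambda$, the head is on the left-most cell, the machine is in the limit state, and every cell contains the $\limsup$ of its values at the stages before $\lambda$. The computation ends when the halt state is reached. An ordinal $\alpha$ is \emph{clockable} if there is a program whose computation on input $0=\langle 000\cdots\rangle$ takes exactly $\alpha$ many steps, in the sense that the $\alpha$-th step, leading from stage $\alpha$ to stage $\alpha+1$, is the act of moving to the halt state; that is, the machine is not in the halt state at any stage $\beta\le\alpha$ and is in the halt state at stage $\alpha+1$. \textbf{Theorem} (Gaps exist in the clockable ordinals). There are ordinals $\alpha<\beta$ such that $\beta$ is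 clockable but $\alpha$ is not. -/

import Mathlib

/-! Infinite time Turing machines. -/

namespace InfiniteTime

/-- Points of Cantor space, the "reals" of the theory. -/
abbrev Real2 : Type := ℕ → Bool

/-- The number `0` as a real: the sequence `000...`. -/
def zeroReal : Real2 := fun _ => false

/-- The three tapes. -/
inductive Tape : Type
  | input
  | scratch
  | output

/-- The simultaneous contents of the three cells under the (single) head. -/
abbrev Column : Type := Tape → Bool

/-- The possible movements of the head in one step. -/
inductive Move : Type
  | left
  | stay
  | right

/-- What an instruction prescribes: the symbols to write, the movement of the head,
and the state to switch to. -/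
structure Action (Q : Type) : Type where
  write : Column
  move : Move
  next : Q

/-- A program: finitely many states, among them three different special states `start`,
`limit`, `halt`, and a table of instructions, which depend on the present state and on the three
bits under the head. (The instructions at the state `halt` are never used by a computation.) -/
structure Program : Type 1 where
  State : Type
  finite_state : Finite State
  start : State
  limit : State
  halt : State
  start_ne_limit : start ≠ limit
  start_ne_halt : start ≠ halt
  limit_ne_halt : limit ≠ halt
  instr : State → Column → Action State

/-- A complete configuration: the state, the position of the head (cell `0` is the left-most cell)
and the contents of all the cells of the three tapes. -/
structure Config (Q : Type) : Type where
  state : Q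
  head : ℕ
  cell : Tape → ℕ → Bool

/-- The new position of the head. A head on the left-most cell that is told to move left
stays where it is. -/
def Move.apply : Move → ℕ → ℕ
  | .left, n => n - 1
  | .stay, n => n
  | .right, n => n + 1

namespace Program

variable (p : Program)

/-- The initial configuration on input `x`: the input is on the input tape, the other
tapes are blank, the head is on the left-most cell in the `start` state. -/
def init (x : Real2) : Config p.State where
  state := p.start
  head := 0
  cell := fun t n =>
    match t with
    | .input => x n
    | .scratch => false
    | .output => false

/-- The instruction that is carried out in the configuration `c`. -/
def action (c : Config p.State) : Action p.State :=
  p.instr c.state (fun t => c.cell t c.head)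

/-- One classical step of computation. -/
def step (c : Config p.State) : Config p.State where
  state := (p.action c).next
  head := (p.action c).move.apply c.head
  cell := fun t n => if n = c.head then (p.action c).write t else c.cell t n

open Classical in
/-- The configuration at a limit stage `l`, from the configurations at the earlier stages:
the `limit` state, the head on the left-most cell, and in every cell the limsup of the
earlier values, which is `1` exactly if the value `1` occurs at stages unbounded in `l`. -/
noncomputable def limitConfig (l : Ordinal.{0}) (c : ∀ γ : Ordinal.{0}, γ < l → Config p.State) :
    Config p.State where
  state := p.limit
  head := 0
  cell := fun t n => decide (∀ β < l, ∃ γ, ∃ h : γ < l, β ≤ γ ∧ (c γ h).cell t n = true)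

/-- The configuration at stage `α` of the computation of `p` on input `x`. This is the
configuration of the computation as long as the `halt` state has not been reached before stage `α`;
the values at later stages carry no meaning and are not used. -/
noncomputable def run (x : Real2) (α : Ordinal.{0}) : Config p.State :=
  Ordinal.limitRecOn α (p.init x) (fun _ c => p.step c) (fun l _ c => p.limitConfig l c)

/-- The computation of `p` on input `x` takes exactly `α` many steps: the `α`-th step, which leads
from stage `α` to stage `α + 1`, is the act of moving to the `halt` state. -/
def TakesExactly (x : Real2) (α : Ordinal.{0}) : Prop :=
  (∀ β ≤ α, (p.run x β).state ≠ p.halt) ∧ (p.run x (α + 1)).state = p.halt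

end Program

/-- An ordinal is clockable if some computation on input `0` takes exactly that many steps. -/
def Clockable (α : Ordinal.{0}) : Prop :=
  ∃ p : Program, p.TakesExactly zeroReal α

end InfiniteTime

/-! ### Finite machine fragments and their composition. -/

namespace InfiniteTime

/-! One machine simulates all programs on input `0` at once and stops when it finds a gap. There are
countably many codes of programs and each halts at no more than one stage, so some multiple of `ω`
is a stage at which no code halts (`exists_forall_not_halts`). Let `ω * α₀` be the least such stage.
It is not clockable, because a program that takes exactly that many steps has a code that halts
there (`exists_halts_of_clockable`). Codes that come from no program are simulated too, but only
this direction is needed.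

The simulating machine works in blocks: block `α` covers the simulated stages from `ω * α` up to `ω
* (α + 1)`. It raises a flag and searches for a code that halts at stage `ω * α`. If one is found,
which by minimality happens for all `α < α₀`, the flag is lowered for good and the remaining finite
steps dovetail the simulation of all codes (`block_of_halts`). If there is none, the search goes on
forever with the flag up (`block_of_not_halts`), so the flag survives the limsup at the end of block
`α₀` and the machine halts there. This happens after stage `ω * α₀` and gives a clockable ordinal
above the gap.

Two things make this precise. First, a random access machine with primitive recursive control is
carried out by finite fragments with unary registers (`eventually_computes`,
`eventually_exists_frag`). Second, cells at limits depend on all earlier stages, so it is not enough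
to know the tapes between simulated steps: every intermediate tape must show an array that the
simulated machine really has. Registers are destroyed by the limsup, so each block spends `ω` stages
on clearing the scratch tape and then `ω` stages on the simulation (`block_trace`). The transfinite
induction over blocks is `Ctl.exists_clockable`; `exists_clockable_gt` applies it to the universal
machine. -/

instance : DecidableEq Tape := fun a b => by
  cases a <;> cases b <;> first | exact isTrue rfl | exact isFalse (by simp)

/-- The contents of all the cells of the three tapes. -/
abbrev Cells : Type := Tape → ℕ → Bool

/-- A configuration without its state. -/
structure Memory where
  head : ℕ
  cell : Cells

/-- The bits under the head. -/
def Memory.column (m : Memory) : Column := fun t => m.cell t m.head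

/-- The effect of an instruction on the memory. -/
def Memory.act {Q : Type} (m : Memory) (a : Action Q) : Memory where
  head := a.move.apply m.head
  cell := fun t n => if n = m.head then a.write t else m.cell t n

/-- Rename the next state of an action. -/
def Action.map {Q R : Type} (f : Q → R) (a : Action Q) : Action R := ⟨a.write, a.move, f a.next⟩

@[simp] theorem Action.map_next {Q R : Type} (f : Q → R) (a : Action Q) :
    (a.map f).next = f a.next := rfl

/-- A machine fragment with finitely many states which is left through one of the exits in `E`. -/
structure Frag (E : Type) where
  Q : Type
  finite : Finite Q
  entry : Q
  instr : Q → Column → Action (Q ⊕ E)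

namespace Frag

variable {E E' : Type}

/-- The fragment goes from a state to a state or exit in at least one step, and the cells satisfy
`P` before each of these steps. -/
inductive Path (F : Frag E) (P : Cells → Prop) : F.Q → Memory → F.Q ⊕ E → Memory → Prop
  | single {q m} : P m.cell → Path F P q m (F.instr q m.column).next (m.act (F.instr q m.column))
  | cons {q m q' s m'} : P m.cell → (F.instr q m.column).next = Sum.inl q' →
      Path F P q' (m.act (F.instr q m.column)) s m' → Path F P q m s m'

/-- The fragment runs from its entry to an exit. -/
def Exec (F : Frag E) (P : Cells → Prop) (m : Memory) (e : E) (m' : Memory) : Prop :=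
  F.Path P F.entry m (Sum.inr e) m'

/-- The predicate `P` records what the tapes look like at every moment of a path, which is what
limit stages depend on. Weakening it lets stretches with different invariants be joined. -/
theorem Path.mono {F : Frag E} {P P' : Cells → Prop} (h : ∀ c, P c → P' c) {q m s m'}
    (H : F.Path P q m s m') : F.Path P' q m s m' := by
  induction H with
  | single h1 => exact .single (h _ h1)
  | cons h1 h2 _ ih => exact .cons (h _ h1) h2 ih

theorem Path.trans {F : Frag E} {P : Cells → Prop} {q m q' m' s m''}
    (H : F.Path P q m (Sum.inl q') m') (H' : F.Path P q' m' s m'') : F.Path P q m s m'' := by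
  generalize hs : (Sum.inl q' : F.Q ⊕ E) = r at H
  induction H with
  | single h1 => exact .cons h1 hs.symm H'
  | cons h1 h2 _ ih => exact .cons h1 h2 (ih H' hs)

/-- Paths are preserved by embeddings of fragments. -/
theorem Path.map {F : Frag E} {G : Frag E'} {P : Cells → Prop} (φ : F.Q → G.Q)
    (ψ : F.Q ⊕ E → G.Q ⊕ E') (hψ : ∀ q, ψ (Sum.inl q) = Sum.inl (φ q))
    (hi : ∀ q c, G.instr (φ q) c = (F.instr q c).map ψ) {q m s m'}
    (H : F.Path P q m s m') : G.Path P (φ q) m (ψ s) m' := by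
  induction H with
  | @single q m h1 =>
    have := Path.single (F := G) (q := φ q) h1
    rwa [hi] at this
  | @cons q m q' s m' h1 h2 _ ih =>
    refine .cons h1 (q' := φ q') ?_ ?_
    · rw [hi, Action.map_next, h2, hψ]
    · rw [hi]; exact ih

/-- A single instruction. -/
def act (f : Column → Action E) : Frag E := ⟨Unit, inferInstance, (), fun _ c => (f c).map Sum.inr⟩

theorem exec_act (f : Column → Action E) {P : Cells → Prop} {m : Memory} (h : P m.cell) :
    (act f).Exec P m (f m.column).next (m.act (f m.column)) :=
  Path.single (F := act f) (q := ()) h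

theorem exec_act_of_eq {f : Column → Action E} {P : Cells → Prop} {h h' : ℕ} {c c' : Cells} {e : E}
    {a : Action E} (ha : f (fun t => c t h) = a) (hc : P c) (he : a.next = e)
    (hh : a.move.apply h = h')
    (hc' : ∀ t n, (if n = h then a.write t else c t n) = c' t n) :
    (act f).Exec P ⟨h, c⟩ e ⟨h', c'⟩ := by
  subst ha
  have := exec_act f (m := ⟨h, c⟩) hc
  obtain rfl : _ = c' := funext fun t => funext fun n => hc' t n
  subst he hh
  exact this

/-- Sequential composition. -/
def bind [Finite E] (F : Frag E) (G : E → Frag E') : Frag E' where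
  Q := F.Q ⊕ Σ e, (G e).Q
  finite := by
    have := F.finite
    have := fun e => (G e).finite
    infer_instance
  entry := Sum.inl F.entry
  instr := fun q c => match q with
    | .inl q => (F.instr q c).map
        (Sum.elim (fun q' => .inl (.inl q')) fun e => .inl (.inr ⟨e, (G e).entry⟩))
    | .inr ⟨e, q⟩ => ((G e).instr q c).map (Sum.elim (fun q' => .inl (.inr ⟨e, q'⟩)) .inr)

theorem Path.bind_left [Finite E] {F : Frag E} (G : E → Frag E') {P : Cells → Prop} {q m e m'}
    (H : F.Path P q m (Sum.inr e) m') :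
    (F.bind G).Path P (Sum.inl q) m (Sum.inl (Sum.inr ⟨e, (G e).entry⟩)) m' :=
  Path.map (G := F.bind G) Sum.inl
    (Sum.elim (fun q' => .inl (.inl q')) fun e => .inl (.inr ⟨e, (G e).entry⟩))
    (fun _ => rfl) (fun _ _ => rfl) H

theorem Path.bind_right [Finite E] (F : Frag E) (G : E → Frag E') (e : E) {P : Cells → Prop}
    {q m s m'} (H : (G e).Path P q m s m') :
    (F.bind G).Path P (Sum.inr ⟨e, q⟩) m
      (Sum.elim (fun q' => .inl (.inr ⟨e, q'⟩)) .inr s) m' :=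
  Path.map (G := F.bind G) (fun q => Sum.inr ⟨e, q⟩)
    (Sum.elim (fun q' => .inl (.inr ⟨e, q'⟩)) .inr) (fun _ => rfl) (fun _ _ => rfl) H

theorem Exec.bind [Finite E] {F : Frag E} {G : E → Frag E'} {P : Cells → Prop} {m e m' e' m''}
    (H : F.Exec P m e m') (H' : (G e).Exec P m' e' m'') : (F.bind G).Exec P m e' m'' :=
  Path.trans (Path.bind_left G H) (Path.bind_right F G e H')

/-- Repeat a fragment as long as it is left through the exit `none`. -/
def loop (F : Frag (Option E)) : Frag E where
  Q := F.Q
  finite := F.finite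
  entry := F.entry
  instr := fun q c => (F.instr q c).map (Sum.elim .inl (fun e : Option E => e.elim (.inl F.entry) .inr))

theorem Path.loop {F : Frag (Option E)} {P : Cells → Prop} {q m s m'} (H : F.Path P q m s m') :
    F.loop.Path P q m (Sum.elim .inl (fun e : Option E => e.elim (.inl F.entry) .inr) s) m' :=
  Path.map (F := F) (G := F.loop) id
    (Sum.elim .inl (fun e : Option E => e.elim (.inl F.entry) .inr)) (fun _ => rfl) (fun _ _ => rfl) H

theorem Exec.loop_next {F : Frag (Option E)} {P : Cells → Prop} {m m' e m''}
    (H : F.Exec P m none m') (H' : F.loop.Exec P m' e m'') : F.loop.Exec P m e m'' :=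
  Path.trans (Path.loop H) H'

theorem Exec.loop_exit {F : Frag (Option E)} {P : Cells → Prop} {m m' e}
    (H : F.Exec P m (some e) m') : F.loop.Exec P m e m' :=
  Path.loop H

theorem Exec.mono {F : Frag E} {P P' : Cells → Prop} (h : ∀ c, P c → P' c) {m e m'}
    (H : F.Exec P m e m') : F.Exec P' m e m' :=
  Path.mono h H

/-- Move the head and leave. -/
def move (d : Move) (e : E) : Frag E := act fun c => ⟨c, d, e⟩

theorem exec_move (d : Move) (e : E) {P : Cells → Prop} {h : ℕ} {c : Cells} (hc : P c) :
    (move d e).Exec P ⟨h, c⟩ e ⟨d.apply h, c⟩ := by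
  refine exec_act_of_eq rfl hc rfl rfl fun t n => ?_
  split_ifs with hn
  · rw [hn]
  · rfl

/-- Move `n` cells to the right. -/
def right : ℕ → Frag Unit
  | 0 => move .stay ()
  | n + 1 => (move .right ()).bind fun _ => right n

theorem exec_right (n : ℕ) {P : Cells → Prop} {h : ℕ} {c : Cells} (hc : P c) :
    (right n).Exec P ⟨h, c⟩ () ⟨h + n, c⟩ := by
  induction n generalizing h with
  | zero => exact exec_move _ _ hc
  | succ n ih =>
    have := (exec_move .right () (h := h) hc).bind (G := fun _ => right n) ih
    rwa [show Move.right.apply h + n = h + (n + 1) by simp [Move.apply]; omega] at this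

/-- Move `n` cells to the left. -/
def left : ℕ → Frag Unit
  | 0 => move .stay ()
  | n + 1 => (move .left ()).bind fun _ => left n

theorem exec_left (n : ℕ) {P : Cells → Prop} {h : ℕ} {c : Cells} (hc : P c) :
    (left n).Exec P ⟨h, c⟩ () ⟨h - n, c⟩ := by
  induction n generalizing h with
  | zero => exact exec_move _ _ hc
  | succ n ih =>
    have := (exec_move .left () (h := h) hc).bind (G := fun _ => left n) ih
    rwa [show Move.left.apply h - n = h - (n + 1) by simp [Move.apply]; omega] at this

/-- Read the bit of one tape under the head. -/
def test (t : Tape) : Frag Bool := act fun c => ⟨c, .stay, c t⟩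

theorem exec_test (t : Tape) {P : Cells → Prop} {h : ℕ} {c : Cells} (hc : P c) :
    (test t).Exec P ⟨h, c⟩ (c t h) ⟨h, c⟩ := by
  refine exec_act_of_eq rfl hc rfl rfl fun t n => ?_
  split_ifs with hn
  · rw [hn]
  · rfl

/-- Write a bit on one tape. -/
def put (t : Tape) (b : Bool) : Frag Unit := act fun c => ⟨Function.update c t b, .stay, ()⟩

theorem exec_put (t : Tape) (b : Bool) {P : Cells → Prop} {h : ℕ} {c : Cells} (hc : P c) :
    (put t b).Exec P ⟨h, c⟩ () ⟨h, Function.update c t (Function.update (c t) h b)⟩ := by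
  refine exec_act_of_eq rfl hc rfl rfl fun t' n => ?_
  by_cases ht : t' = t
  · subst ht
    by_cases hn : n = h
    · subst hn; simp
    · simp [hn]
  · by_cases hn : n = h
    · subst hn; simp [ht]
    · simp [hn, ht]

/-- Go to the left-most cell, which carries the only `1` of the output tape. -/
def home (e : E) : Frag E :=
  loop ((test .output).bind fun b => if b then move .stay (some e) else move .left none)

theorem exec_home (e : E) {P : Cells → Prop} {h : ℕ} {c : Cells} (hc : P c)
    (ho : ∀ n, c .output n = decide (n = 0)) : (home e).Exec P ⟨h, c⟩ e ⟨0, c⟩ := by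
  induction h with
  | zero =>
    refine Exec.loop_exit ((exec_test _ hc).bind ?_)
    rw [ho]
    exact exec_move .stay _ hc
  | succ h ih =>
    refine Exec.loop_next ((exec_test _ hc).bind ?_) ih
    rw [ho]
    simp only [Nat.add_eq_zero_iff, one_ne_zero, and_false, decide_false, Bool.false_eq_true,
      if_false]
    exact exec_move .left _ hc

end Frag

end InfiniteTime

/-! ### Unary registers and primitive recursive functions. -/

namespace InfiniteTime

open Frag

/-- The tapes with the array `A` on the input tape and the registers `σ j` in unary on the scratch
tape, both at distance `K`; the output tape marks the left-most cell. -/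
def store (K : ℕ) (A : ℕ → Bool) (σ : ℕ → ℕ) : Cells := fun t n =>
  match t with
  | .input => if n % K = 0 then A (n / K) else false
  | .scratch => decide (n / K < σ (n % K))
  | .output => decide (n = 0)

theorem store_scratch {K : ℕ} {A : ℕ → Bool} {σ : ℕ → ℕ} {j u : ℕ} (hj : j < K) :
    store K A σ .scratch (K * u + j) = decide (u < σ j) := by
  have h1 : (K * u + j) / K = u := by
    rw [Nat.mul_add_div (by omega), Nat.div_eq_of_lt hj, add_zero]
  have h2 : (K * u + j) % K = j := by
    rw [Nat.mul_add_mod, Nat.mod_eq_of_lt hj]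
  simp [store, h1, h2]

theorem store_input {K : ℕ} (hK : 0 < K) {A : ℕ → Bool} {σ : ℕ → ℕ} {u : ℕ} :
    store K A σ .input (K * u) = A u := by
  simp [store, Nat.mul_div_cancel_left _ hK]

theorem eq_mul_add_iff {K n u j : ℕ} (hj : j < K) : n = K * u + j ↔ n / K = u ∧ n % K = j := by
  constructor
  · rintro rfl
    exact ⟨by rw [Nat.mul_add_div (by omega), Nat.div_eq_of_lt hj, add_zero],
      by rw [Nat.mul_add_mod, Nat.mod_eq_of_lt hj]⟩
  · rintro ⟨rfl, rfl⟩
    exact (Nat.div_add_mod n K).symm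

/-- The register `j` lives on the cells congruent to `j` modulo `K`, and `K * σ j + j` is the first
of them that carries a `0`. -/
theorem store_put_scratch_true {K : ℕ} {A : ℕ → Bool} {σ : ℕ → ℕ} {j : ℕ} (hj : j < K) :
    Function.update (store K A σ) .scratch
      (Function.update (store K A σ .scratch) (K * σ j + j) true) =
    store K A (Function.update σ j (σ j + 1)) := by
  funext t n
  cases t
  · rfl
  · simp only [Function.update_self]
    by_cases hn : n = K * σ j + j
    · rw [hn, store_scratch hj]; simp
    · rw [Function.update_of_ne hn]
      rw [eq_mul_add_iff hj] at hn
      by_cases h : n % K = j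
      · simp only [store, h, Function.update_self, decide_eq_decide]
        have : n / K ≠ σ j := fun h' => hn ⟨h', h⟩
        omega
      · simp [store, h]
  · rfl

theorem store_put_scratch_false {K : ℕ} {A : ℕ → Bool} {σ : ℕ → ℕ} {j v : ℕ} (hj : j < K)
    (hv : σ j = v + 1) :
    Function.update (store K A σ) .scratch
      (Function.update (store K A σ .scratch) (K * v + j) false) =
    store K A (Function.update σ j v) := by
  funext t n
  cases t
  · rfl
  · simp only [Function.update_self]
    by_cases hn : n = K * v + j
    · rw [hn, store_scratch hj]; simp
    · rw [Function.update_of_ne hn]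
      rw [eq_mul_add_iff hj] at hn
      by_cases h : n % K = j
      · simp only [store, h, Function.update_self, decide_eq_decide]
        have : n / K ≠ v := fun h' => hn ⟨h', h⟩
        omega
      · simp [store, h]
  · rfl

theorem store_put_input {K : ℕ} (hK : 0 < K) {A : ℕ → Bool} {σ : ℕ → ℕ} {v : ℕ} {b : Bool} :
    Function.update (store K A σ) .input (Function.update (store K A σ .input) (K * v) b) =
    store K (Function.update A v b) σ := by
  funext t n
  cases t
  · simp only [Function.update_self]
    by_cases hn : n = K * v
    · rw [hn, store_input hK]; simp
    · rw [Function.update_of_ne hn]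
      rw [← add_zero (K * v), eq_mul_add_iff hK] at hn
      by_cases h : n % K = 0
      · have : n / K ≠ v := fun h' => hn ⟨h', h⟩
        simp [store, h, Function.update_of_ne this]
      · simp [store, h]
  · rfl
  · rfl

/-- The cells hold the array `A` and some registers. -/
def IsStore (K : ℕ) (A : ℕ → Bool) (c : Cells) : Prop := ∃ σ, c = store K A σ

theorem isStore_store (K : ℕ) (A : ℕ → Bool) (σ : ℕ → ℕ) : IsStore K A (store K A σ) := ⟨σ, rfl⟩

/-- Go to the end of the unary number below the head. -/
def walk (K : ℕ) : Frag Unit :=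
  loop ((test .scratch).bind fun b =>
    if b then (right K).bind fun _ => move .stay none else move .stay (some ()))

theorem exec_walk {K : ℕ} {A : ℕ → Bool} {σ : ℕ → ℕ} {j u : ℕ} (hj : j < K) (hu : u ≤ σ j) :
    (walk K).Exec (IsStore K A) ⟨K * u + j, store K A σ⟩ () ⟨K * σ j + j, store K A σ⟩ := by
  obtain ⟨d, hd⟩ := Nat.exists_eq_add_of_le hu
  induction d generalizing u with
  | zero =>
    obtain rfl : σ j = u := hd
    refine Exec.loop_exit ((exec_test _ (isStore_store ..)).bind ?_)
    rw [store_scratch hj]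
    simp only [lt_irrefl, decide_false, Bool.false_eq_true, if_false]
    exact exec_move .stay _ (isStore_store ..)
  | succ d ih =>
    refine Exec.loop_next ((exec_test _ (isStore_store ..)).bind ?_) (ih (u := u + 1) ?_ ?_)
    · rw [store_scratch hj]
      have : u < σ j := by omega
      simp only [this, decide_true, if_true]
      refine (exec_right K (isStore_store ..)).bind ?_
      have := exec_move (P := IsStore K A) .stay (none : Option Unit) (h := K * (u + 1) + j)
        (isStore_store K A σ)
      rwa [show K * u + j + K = K * (u + 1) + j by ring]
    · omega
    · omega

/-- The fragment changes the registers from `σ` to `σ'`, whatever the array is, and leaves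
through `e`. -/
def Reg {E : Type} (K : ℕ) (F : Frag E) (σ : ℕ → ℕ) (e : E) (σ' : ℕ → ℕ) : Prop :=
  ∀ A, F.Exec (IsStore K A) ⟨0, store K A σ⟩ e ⟨0, store K A σ'⟩

theorem Reg.bind {E E' : Type} [Finite E] {K : ℕ} {F : Frag E} {G : E → Frag E'} {σ e σ' e' σ''}
    (h : Reg K F σ e σ') (h' : Reg K (G e) σ' e' σ'') : Reg K (F.bind G) σ e' σ'' :=
  fun A => (h A).bind (h' A)

theorem Reg.loop_next {E : Type} {K : ℕ} {F : Frag (Option E)} {σ σ' e σ''}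
    (h : Reg K F σ none σ') (h' : Reg K F.loop σ' e σ'') : Reg K F.loop σ e σ'' :=
  fun A => (h A).loop_next (h' A)

theorem Reg.loop_exit {E : Type} {K : ℕ} {F : Frag (Option E)} {σ σ' e}
    (h : Reg K F σ (some e) σ') : Reg K F.loop σ e σ' :=
  fun A => (h A).loop_exit

theorem reg_stay {E : Type} {K : ℕ} {σ : ℕ → ℕ} (e : E) : Reg K (move .stay e) σ e σ :=
  fun _ => exec_move .stay e (isStore_store ..)

theorem exec_home_store {E : Type} {K : ℕ} {A : ℕ → Bool} {σ : ℕ → ℕ} {h : ℕ} (e : E) :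
    (home e).Exec (IsStore K A) ⟨h, store K A σ⟩ e ⟨0, store K A σ⟩ :=
  exec_home e (isStore_store ..) fun _ => rfl

/-- Go to the end of the register `j`. -/
def goto (K j : ℕ) : Frag Unit := (right j).bind fun _ => walk K

theorem exec_goto {K : ℕ} {A : ℕ → Bool} {σ : ℕ → ℕ} {j : ℕ} (hj : j < K) :
    (goto K j).Exec (IsStore K A) ⟨0, store K A σ⟩ () ⟨K * σ j + j, store K A σ⟩ := by
  refine (exec_right j (isStore_store ..)).bind ?_
  have := exec_walk (A := A) (σ := σ) (u := 0) hj (Nat.zero_le _)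
  rwa [mul_zero] at this

/-- Add `1` to the register `j`. -/
def inc (K j : ℕ) : Frag Unit :=
  (goto K j).bind fun _ => (put .scratch true).bind fun _ => home ()

theorem reg_inc {K : ℕ} {σ : ℕ → ℕ} {j : ℕ} (hj : j < K) :
    Reg K (inc K j) σ () (Function.update σ j (σ j + 1)) := fun A => by
  refine (exec_goto hj).bind ((exec_put _ _ (isStore_store ..)).bind ?_)
  rw [store_put_scratch_true hj]
  exact exec_home_store ()

/-- Subtract `1` from the register `j` if it is not `0`, and tell whether this was so. -/
def tryDec (K j : ℕ) : Frag Bool :=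
  (right j).bind fun _ => (test .scratch).bind fun b =>
    if b then (walk K).bind fun _ => (left K).bind fun _ => (put .scratch false).bind fun _ =>
      home true
    else home false

theorem reg_tryDec_zero {K : ℕ} {σ : ℕ → ℕ} {j : ℕ} (hj : j < K) (h : σ j = 0) :
    Reg K (tryDec K j) σ false σ := fun A => by
  refine (exec_right j (isStore_store ..)).bind ((exec_test _ (isStore_store ..)).bind ?_)
  have := store_scratch (A := A) (σ := σ) (u := 0) hj
  rw [mul_zero] at this
  rw [this, h]
  exact exec_home_store false

theorem reg_tryDec_succ {K : ℕ} {σ : ℕ → ℕ} {j v : ℕ} (hj : j < K) (h : σ j = v + 1) :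
    Reg K (tryDec K j) σ true (Function.update σ j v) := fun A => by
  refine (exec_right j (isStore_store ..)).bind ((exec_test _ (isStore_store ..)).bind ?_)
  have h1 := store_scratch (A := A) (σ := σ) (u := 0) hj
  have h2 := exec_walk (A := A) (σ := σ) (u := 0) hj (Nat.zero_le _)
  rw [mul_zero] at h1 h2
  rw [h1]
  simp only [h, Nat.zero_lt_succ, decide_true, if_true]
  refine h2.bind ((exec_left K (isStore_store ..)).bind ((exec_put _ _ (isStore_store ..)).bind ?_))
  -- The walk ends on the first `0` of the register; the last `1`, which has to go, is `K` cells
  -- further left.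
  rw [h, show K * (v + 1) + j - K = K * v + j by rw [mul_add]; omega,
    store_put_scratch_false hj h]
  exact exec_home_store true

/-- Some fragment changes the registers according to the relation `Q`. -/
def Can (K : ℕ) (Q : (ℕ → ℕ) → (ℕ → ℕ) → Prop) : Prop :=
  ∃ F : Frag Unit, ∀ σ, ∃ σ', Reg K F σ () σ' ∧ Q σ σ'

theorem Can.mono {K : ℕ} {Q Q' : (ℕ → ℕ) → (ℕ → ℕ) → Prop} (h : Can K Q)
    (hQ : ∀ σ σ', Q σ σ' → Q' σ σ') : Can K Q' := by
  obtain ⟨F, hF⟩ := h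
  refine ⟨F, fun σ => ?_⟩
  obtain ⟨σ', h1, h2⟩ := hF σ
  exact ⟨σ', h1, hQ _ _ h2⟩

theorem Can.seq {K : ℕ} {Q Q' R : (ℕ → ℕ) → (ℕ → ℕ) → Prop} (h : Can K Q) (h' : Can K Q')
    (hR : ∀ σ τ ρ, Q σ τ → Q' τ ρ → R σ ρ) : Can K R := by
  obtain ⟨F, hF⟩ := h
  obtain ⟨G, hG⟩ := h'
  refine ⟨F.bind fun _ => G, fun σ => ?_⟩
  obtain ⟨τ, h1, h2⟩ := hF σ
  obtain ⟨ρ, h3, h4⟩ := hG τ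
  exact ⟨ρ, h1.bind h3, hR _ _ _ h2 h4⟩

theorem can_nop {K : ℕ} : Can K fun σ σ' => σ' = σ :=
  ⟨move .stay (), fun σ => ⟨σ, reg_stay (), rfl⟩⟩

theorem can_inc {K j : ℕ} (hj : j < K) :
    Can K fun σ σ' => σ' = Function.update σ j (σ j + 1) :=
  ⟨inc K j, fun _ => ⟨_, reg_inc hj, rfl⟩⟩

/-- Repeat a fragment as often as the register `j` says, while counting down that register. -/
theorem Can.repeat {K j : ℕ} (hj : j < K) {Q R : (ℕ → ℕ) → (ℕ → ℕ) → Prop} (h : Can K Q)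
    (h0 : ∀ σ, σ j = 0 → R σ σ)
    (hs : ∀ σ τ v, σ j = v + 1 → Q (Function.update σ j v) τ →
      τ j = v ∧ ∀ ρ, R τ ρ → R σ ρ) : Can K R := by
  obtain ⟨F, hF⟩ := h
  refine ⟨loop ((tryDec K j).bind fun b =>
    if b then F.bind fun _ => move .stay none else move .stay (some ())), fun σ => ?_⟩
  generalize hv : σ j = v
  induction v generalizing σ with
  | zero =>
    exact ⟨σ, Reg.loop_exit ((reg_tryDec_zero hj hv).bind (reg_stay _)), h0 σ hv⟩
  | succ v ih =>
    obtain ⟨τ, h1, h2⟩ := hF (Function.update σ j v)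
    obtain ⟨h3, h4⟩ := hs σ τ v hv h2
    obtain ⟨ρ, h5, h6⟩ := ih τ h3
    exact ⟨ρ, Reg.loop_next ((reg_tryDec_succ hj hv).bind (h1.bind (reg_stay _))) h5, h4 ρ h6⟩

theorem can_clear {K j : ℕ} (hj : j < K) : Can K fun σ σ' => σ' = Function.update σ j 0 :=
  -- The countdown of an empty loop already clears its register.
  can_nop.repeat hj (fun σ h => by rw [← h, Function.update_eq_self]) fun σ τ v _ h2 => by
    subst h2
    simp

/-- Add the register `i` to `j` and to `k`, and clear `i`. -/
theorem can_move_two {K i j k : ℕ} (hi : i < K) (hj : j < K) (hk : k < K) (hij : i ≠ j)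
    (hik : i ≠ k) (hjk : j ≠ k) : Can K fun σ σ' => σ' i = 0 ∧ σ' j = σ j + σ i ∧
      σ' k = σ k + σ i ∧ ∀ r, r ≠ i → r ≠ j → r ≠ k → σ' r = σ r := by
  refine ((can_inc hj).seq (can_inc hk) (R := fun σ σ' => σ' i = σ i ∧ σ' j = σ j + 1 ∧
    σ' k = σ k + 1 ∧ ∀ r, r ≠ i → r ≠ j → r ≠ k → σ' r = σ r) ?_).repeat hi ?_ ?_
  · rintro σ _ _ rfl rfl
    refine ⟨by simp [hij, hik], by simp [hjk], by simp [hjk.symm], fun r _ h2 h3 => ?_⟩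
    simp [h2, h3]
  · intro σ h
    simp [h]
  · rintro σ τ v hv ⟨h1, h2, h3, h4⟩
    rw [Function.update_self] at h1
    rw [Function.update_of_ne hij.symm] at h2
    rw [Function.update_of_ne hik.symm] at h3
    refine ⟨h1, fun ρ ⟨g1, g2, g3, g4⟩ => ⟨g1, by omega, by omega, fun r hr hr2 hr3 => ?_⟩⟩
    rw [g4 r hr hr2 hr3, h4 r hr hr2 hr3, Function.update_of_ne hr]

/-- Add the register `i` to `j`, and clear `i`. -/
theorem can_move {K i j : ℕ} (hi : i < K) (hj : j < K) (hij : i ≠ j) :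
    Can K fun σ σ' => σ' i = 0 ∧ σ' j = σ j + σ i ∧ ∀ r, r ≠ i → r ≠ j → σ' r = σ r := by
  refine (can_inc hj).repeat hi ?_ ?_
  · intro σ h
    simp [h]
  · rintro σ τ v hv rfl
    refine ⟨by simp [hij], fun ρ ⟨g1, g2, g3⟩ => ⟨g1, ?_, fun r hr hr2 => ?_⟩⟩
    · rw [g2]; simp [hij, hij.symm]; omega
    · rw [g3 r hr hr2]; simp [hr, hr2]

/-- Copy the register `i` to the register `j`, with the help of the register `k`. -/
theorem can_copy {K i j k : ℕ} (hi : i < K) (hj : j < K) (hk : k < K) (hij : i ≠ j) (hik : i ≠ k)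
    (hjk : j ≠ k) : Can K fun σ σ' => σ' j = σ i ∧ ∀ r, r ≠ j → r ≠ k → σ' r = σ r := by
  -- Unary reading is destructive: `i` is emptied into `j` and `k` together, then refilled from `k`.
  refine (((can_clear hj).seq (can_clear hk) (R := fun σ σ' => σ' j = 0 ∧ σ' k = 0 ∧
      ∀ r, r ≠ j → r ≠ k → σ' r = σ r) ?_).seq
    (can_move_two hi hj hk hij hik hjk) (R := fun σ σ' => σ' i = 0 ∧ σ' j = σ i ∧ σ' k = σ i ∧
      ∀ r, r ≠ i → r ≠ j → r ≠ k → σ' r = σ r) ?_).seq (can_move hk hi hik.symm) ?_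
  · rintro σ _ _ rfl rfl
    refine ⟨by simp [hjk], by simp, fun r h1 h2 => ?_⟩
    simp [h1, h2]
  · rintro σ τ ρ ⟨h1, h2, h3⟩ ⟨g1, g2, g3, g4⟩
    rw [h3 i hij hik] at g2 g3
    exact ⟨g1, by omega, by omega, fun r a b c => by rw [g4 r a b c, h3 r b c]⟩
  · rintro σ τ ρ ⟨h1, h2, h3, h4⟩ ⟨g1, g2, g3⟩
    refine ⟨by rw [g3 j hjk hij.symm, h2], fun r a b => ?_⟩
    by_cases hr : r = i
    · subst hr; omega
    · rw [g3 r b hr, h4 r hr a b]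

/-- Some fragment puts the value of `f` at the registers `ins` into the register `out`, and leaves
alone all other registers below `B`. -/
def Computes (K : ℕ) {n : ℕ} (f : List.Vector ℕ n → ℕ) (ins : Fin n → ℕ) (out B : ℕ) : Prop :=
  Can K fun σ σ' => σ' out = f (List.Vector.ofFn fun i => σ (ins i)) ∧
    ∀ r < B, r ≠ out → σ' r = σ r

open Filter in
/-- Several functions can be computed one after the other. -/
theorem eventually_computes_all {n m : ℕ} {g : Fin n → List.Vector ℕ m → ℕ} {ins : Fin m → ℕ}
    {B : ℕ} (hins : ∀ i, ins i < B)
    (h : ∀ i, ∀ out B', (∀ i, ins i < B') → (∀ i, ins i ≠ out) → out < B' →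
      ∀ᶠ K in atTop, Computes K (g i) ins out B') (l : ℕ) (hl : l ≤ n) :
    ∀ᶠ K in atTop, Can K fun σ σ' => (∀ i : Fin n, i.1 < l → σ' (B + i) =
        g i (List.Vector.ofFn fun i => σ (ins i))) ∧ ∀ r < B, σ' r = σ r := by
  induction l with
  | zero => exact Eventually.of_forall fun K => can_nop.mono fun σ σ' h => by simp [h]
  | succ l ih =>
    have hb : ∀ i, ins i < B + n := fun i => (hins i).trans_le (by omega)
    filter_upwards [ih (by omega), h ⟨l, hl⟩ (B + l) (B + n) hb
      (fun i => ((hins i).trans_le (by omega)).ne) (by omega)] with K h1 h2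
    refine h1.seq h2 ?_
    rintro σ τ ρ ⟨a1, a2⟩ ⟨b1, b2⟩
    refine ⟨fun i hi => ?_, fun r hr => ?_⟩
    · by_cases hil : i.1 = l
      · obtain rfl : i = ⟨l, hl⟩ := Fin.ext hil
        rw [b1]
        simp only [a2 _ (hins _)]
      · rw [b2 _ (by omega) (by omega), a1 i (by omega)]
    · rw [b2 r (by omega) (by omega), a2 r hr]

open Filter in
/-- All primitive recursive functions can be computed. -/
theorem eventually_computes {n : ℕ} {f : List.Vector ℕ n → ℕ} (hf : Nat.Primrec' f) :
    ∀ (ins : Fin n → ℕ) (out B : ℕ), (∀ i, ins i < B) → (∀ i, ins i ≠ out) → out < B →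
      ∀ᶠ K in atTop, Computes K f ins out B := by
  -- The spacing `K` is also the number of available registers. Asking for all large `K` lets the
  -- finitely many parts of a computation share one `K`, and the varying `B` gives each part fresh
  -- work space above the registers to be protected.
  induction hf with
  | zero =>
    intro ins out B _ _ ho
    filter_upwards [eventually_gt_atTop B] with K hK
    refine (can_clear (ho.trans hK)).mono ?_
    rintro σ _ rfl
    exact ⟨by simp, fun r _ hr => by simp [hr]⟩
  | succ =>
    intro ins out B hi hio ho
    filter_upwards [eventually_gt_atTop B] with K hK
    refine ((can_copy (k := B) ((hi 0).trans hK) (ho.trans hK) hK (hio 0) (hi 0).ne ho.ne).seq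
      (can_inc (ho.trans hK))) ?_
    rintro σ τ _ ⟨h1, h2⟩ rfl
    exact ⟨by simp [h1, List.Vector.ofFn], fun r hr hro => by simp [hro, h2 r hro hr.ne]⟩
  | get i =>
    intro ins out B hi hio ho
    filter_upwards [eventually_gt_atTop B] with K hK
    refine (can_copy (k := B) ((hi i).trans hK) (ho.trans hK) hK (hio i) (hi i).ne ho.ne).mono ?_
    rintro σ τ ⟨h1, h2⟩
    exact ⟨by simp [h1], fun r hr hro => h2 r hro hr.ne⟩
  | @comp m n f g _ _ ihf ihg =>
    intro ins out B hi hio ho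
    -- The inner values are collected in the registers from `B` to `B + n - 1`, so the outer
    -- function works with the bound `B + n`.
    filter_upwards [eventually_computes_all hi (fun i => ihg i ins) _ le_rfl,
      ihf (fun i => B + i) out (B + n) (fun i => by omega) (fun i => by omega) (by omega)]
      with K h1 h2
    refine h1.seq h2 ?_
    rintro σ τ ρ ⟨a1, a2⟩ ⟨b1, b2⟩
    refine ⟨?_, fun r hr hro => by rw [b2 r (by omega) hro, a2 r hr]⟩
    rw [b1]
    congr 2
    funext i
    rw [a1 i i.2]
  | @prec n f g _ _ ihf ihg =>
    intro ins out B hi hio ho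
    -- Work space of the recursion: `B` is the argument reached so far, `B + 1` the value there, `B
    -- + 2` the number of rounds left, `B + 3` the new value, `B + 4` an aid for copying.
    let insg : Fin (n + 2) → ℕ := Fin.cons B (Fin.cons (B + 1) fun i => ins i.succ)
    have hg := ihg insg (B + 3) (B + 4)
      (Fin.cases (by simp [insg]) (Fin.cases (by simp [insg]) fun i => by
        have := hi i.succ; simp [insg]; omega))
      (Fin.cases (by simp [insg]) (Fin.cases (by simp [insg]) fun i => by
        have := hi i.succ; simp [insg]; omega)) (by omega)
    filter_upwards [eventually_gt_atTop (B + 4), hg, ihf (fun i => ins i.succ) (B + 1) (B + 4)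
      (fun i => (hi i.succ).trans_le (by omega)) (fun i => by have := hi i.succ; omega) (by omega)]
      with K hK hg hf
    let G : (ℕ → ℕ) → ℕ → ℕ := fun σ x => Nat.rec (f (List.Vector.ofFn fun i => σ (ins i.succ)))
      (fun y IH => g (y ::ᵥ IH ::ᵥ List.Vector.ofFn fun i => σ (ins i.succ))) x
    have hG : ∀ σ τ : ℕ → ℕ, (∀ r < B, σ r = τ r) → G σ = G τ := by
      intro σ τ h
      simp only [G, h _ (hi _)]
    have hi0 := hi 0
    -- `Can` speaks of all register contents, so the loop invariant has to enter as a premise.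
    have body : Can K fun σ σ' => (σ (B + 1) = G σ (σ B) → σ' (B + 1) = G σ (σ B + 1)) ∧
        σ' B = σ B + 1 ∧ σ' (B + 2) = σ (B + 2) ∧ ∀ r < B, σ' r = σ r := by
      refine (hg.seq (can_copy (i := B + 3) (j := B + 1) (k := B + 4) (by omega) (by omega)
        (by omega) (by omega) (by omega) (by omega)) (R := fun σ σ' =>
          (σ (B + 1) = G σ (σ B) → σ' (B + 1) = G σ (σ B + 1)) ∧
          σ' B = σ B ∧ σ' (B + 2) = σ (B + 2) ∧ ∀ r < B, σ' r = σ r) ?_).seq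
        (can_inc (j := B) (by omega)) ?_
      · rintro σ τ ρ ⟨h1, h2⟩ ⟨h3, h4⟩
        refine ⟨fun h => ?_, ?_, ?_, fun r hr => ?_⟩
        · rw [h3, h1, show (List.Vector.ofFn fun i => σ (insg i)) =
            σ B ::ᵥ σ (B + 1) ::ᵥ List.Vector.ofFn fun i => σ (ins i.succ) from rfl, h]
        · rw [h4 _ (by omega) (by omega), h2 _ (by omega) (by omega)]
        · rw [h4 _ (by omega) (by omega), h2 _ (by omega) (by omega)]
        · rw [h4 _ (by omega) (by omega), h2 _ (by omega) (by omega)]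
      · rintro σ τ _ ⟨h1, h2, h3, h4⟩ rfl
        refine ⟨by simpa using h1, by simp [h2], by simp [h3], fun r hr => ?_⟩
        rw [Function.update_of_ne (by omega), h4 r hr]
    have iter : Can K fun σ σ' => (σ (B + 1) = G σ (σ B) →
        σ' (B + 1) = G σ (σ B + σ (B + 2))) ∧ ∀ r < B, σ' r = σ r := by
      refine body.repeat (j := B + 2) (by omega) ?_ ?_
      · intro σ h
        simp [h]
      · rintro σ τ v hv ⟨h1, h2, h3, h4⟩
        have hGs : G (Function.update σ (B + 2) v) = G σ := hG _ _ fun r hr => by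
          rw [Function.update_of_ne (by omega)]
        have hGt : G τ = G σ := hG _ _ fun r hr => by
          rw [h4 r hr, Function.update_of_ne (by omega)]
        simp only [hGs, Function.update_of_ne (show B ≠ B + 2 by omega),
          Function.update_of_ne (show B + 1 ≠ B + 2 by omega), Function.update_self] at h1 h2 h3
        refine ⟨h3, fun ρ ⟨g1, g2⟩ => ⟨fun h => ?_, fun r hr => ?_⟩⟩
        · rw [hGt, h2, h3] at g1
          rw [g1 (h1 h), hv, Nat.add_assoc, Nat.add_comm 1]
        · rw [g2 r hr, h4 r hr, Function.update_of_ne (by omega)]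
    have start : Can K fun σ σ' => σ' (B + 1) = G σ 0 ∧ σ' B = 0 ∧ σ' (B + 2) = σ (ins 0) ∧
        ∀ r < B, σ' r = σ r := by
      refine (hf.seq (can_copy (i := ins 0) (j := B + 2) (k := B + 4) (by omega) (by omega)
        (by omega) (by omega) (by omega) (by omega)) (R := fun σ σ' => σ' (B + 1) = G σ 0 ∧
          σ' (B + 2) = σ (ins 0) ∧ ∀ r < B, σ' r = σ r) ?_).seq (can_clear (j := B) (by omega)) ?_
      · rintro σ τ ρ ⟨h1, h2⟩ ⟨h3, h4⟩
        refine ⟨?_, ?_, fun r hr => ?_⟩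
        · rw [h4 _ (by omega) (by omega)]
          exact h1
        · rw [h3, h2 _ (by omega) (by omega)]
        · rw [h4 _ (by omega) (by omega), h2 _ (by omega) (by omega)]
      · rintro σ τ _ ⟨h1, h2, h3⟩ rfl
        refine ⟨by simp [h1], by simp, by simp [h2], fun r hr => ?_⟩
        rw [Function.update_of_ne (by omega), h3 r hr]
    refine (start.seq iter (R := fun σ σ' => σ' (B + 1) = G σ (σ (ins 0)) ∧ ∀ r < B, σ' r = σ r)
      ?_).seq (can_copy (i := B + 1) (j := out) (k := B + 2) (by omega) (by omega)
        (by omega) (by omega) (by omega) (by omega)) ?_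
    · rintro σ τ ρ ⟨h1, h2, h3, h4⟩ ⟨h5, h6⟩
      rw [hG τ σ h4, h2, zero_add, h3] at h5
      exact ⟨h5 h1, fun r hr => by rw [h6 r hr, h4 r hr]⟩
    · rintro σ τ ρ ⟨h1, h2⟩ ⟨h3, h4⟩
      refine ⟨?_, fun r hr hro => by rw [h4 r hro (by omega), h2 r hr]⟩
      rw [h3, h1]
      simp [G, List.Vector.ofFn]

end InfiniteTime

/-! ### Random access machines with primitive recursive control. -/

namespace InfiniteTime

open Frag

/-- A machine with states in `X`, possibly infinitely many, and random access to an array of bits.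
In each step it reads a cell, maybe writes to this cell, and goes to a new state. -/
structure Ctl (X : Type) [Primcodable X] where
  init : X
  addr : X → ℕ
  write : X → Option Bool
  next : X → Bool → X
  primrec_addr : Primrec addr
  primrec_write : Primrec write
  primrec_next : Primrec₂ next

namespace Ctl

variable {X : Type} [Primcodable X] (M : Ctl X)

/-- The array after one step. -/
def array (x : X) (A : ℕ → Bool) : ℕ → Bool :=
  Function.update A (M.addr x) ((M.write x).getD (A (M.addr x)))

/-- One step. -/
def step (s : X × (ℕ → Bool)) : X × (ℕ → Bool) :=
  (M.next s.1 (s.2 (M.addr s.1)), M.array s.1 s.2)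

/-- The state with a given number. -/
def dec (n : ℕ) : X := Nat.casesOn n M.init fun m => (Encodable.decode m).getD M.init

/-- The shift by one reserves the number `0` for `M.init`: a blank scratch tape, on which all
registers are `0`, stands for the initial state. -/
theorem dec_encode (x : X) : M.dec (Encodable.encode x + 1) = x := by
  simp [dec]

theorem primrec_dec : Primrec M.dec :=
  Primrec.nat_casesOn Primrec.id (Primrec.const _)
    ((Primrec.option_getD.comp (Primrec.decode.comp Primrec.snd) (Primrec.const _)))

-- Register `1` holds the control state throughout; registers `0` and `2` receive the address and
-- the code of the bit to write. As functions of register `1` both are primitive recursive.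
open Filter in
theorem eventually_prepare : ∀ᶠ K in atTop, Can K fun σ σ' => σ' 0 = M.addr (M.dec (σ 1)) ∧
    σ' 1 = σ 1 ∧ σ' 2 = Encodable.encode (M.write (M.dec (σ 1))) := by
  have h1 := Nat.Primrec'.prim_iff₁.2 (M.primrec_addr.comp M.primrec_dec)
  have h2 := Nat.Primrec'.prim_iff₁.2
    (Primrec.encode.comp (M.primrec_write.comp M.primrec_dec))
  filter_upwards [eventually_computes h1 (fun _ => 1) 0 3 (by simp) (by simp) (by simp),
    eventually_computes h2 (fun _ => 1) 2 3 (by simp) (by simp) (by simp)] with K k1 k2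
  refine k1.seq k2 ?_
  rintro σ τ ρ ⟨a1, a2⟩ ⟨b1, b2⟩
  have h := a2 1 (by simp) (by simp)
  refine ⟨?_, ?_, ?_⟩
  · rw [b2 0 (by simp) (by simp), a1]; rfl
  · rw [b2 1 (by simp) (by simp), h]
  · rw [b1, ← h]; rfl

-- The bit that was read is remembered by the finite control, hence one fragment for each `b`. The
-- new state is computed in register `0` and then copied, since an output register of `Computes` may
-- not be an input.
open Filter in
theorem eventually_finish : ∀ᶠ K in atTop, ∀ b : Bool, Can K fun σ σ' =>
    M.dec (σ' 1) = M.next (M.dec (σ 1)) b := by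
  refine eventually_all.2 fun b => ?_
  have h1 := Nat.Primrec'.prim_iff₁.2 (Primrec.succ.comp (Primrec.encode.comp
    (M.primrec_next.comp M.primrec_dec (Primrec.const b))))
  filter_upwards [eventually_computes h1 (fun _ => 1) 0 2 (by simp) (by simp) (by simp),
    eventually_gt_atTop 2] with K k1 k2
  refine k1.seq (can_copy (i := 0) (j := 1) (k := 2) (by omega) (by omega) k2 (by simp) (by simp)
    (by simp)) ?_
  rintro σ τ ρ ⟨a1, a2⟩ ⟨b1, b2⟩
  rw [b1, a1]
  exact M.dec_encode _

/-- Read the register `2` as a bit to be written. -/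
def fetch (K : ℕ) : Frag (Option Bool) :=
  (tryDec K 2).bind fun b => if b then (tryDec K 2).bind fun b' => move .stay (some b')
    else move .stay none

/-- The codes of `none`, `some false` and `some true` are `0`, `1` and `2`, which two attempts to
decrement tell apart. -/
theorem exists_reg_fetch {K : ℕ} (hK : 2 < K) {σ : ℕ → ℕ} {w : Option Bool}
    (h : σ 2 = Encodable.encode w) :
    ∃ σ', Reg K (fetch K) σ w σ' ∧ σ' 0 = σ 0 ∧ σ' 1 = σ 1 := by
  rcases w with _ | _ | _
  · exact ⟨_, (reg_tryDec_zero hK h).bind (reg_stay _), rfl, rfl⟩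
  · refine ⟨_, (reg_tryDec_succ hK h).bind
      ((reg_tryDec_zero hK (by rw [Function.update_self]; rfl)).bind (reg_stay _)), ?_, ?_⟩ <;> simp
  · refine ⟨_, (reg_tryDec_succ hK h).bind
      ((reg_tryDec_succ hK (v := 0) (by rw [Function.update_self]; rfl)).bind (reg_stay _)),
      ?_, ?_⟩ <;> simp

/-- Read, and maybe write, the array at the index in the register `0`. -/
def access (K : ℕ) (w : Option Bool) : Frag Bool :=
  (goto K 0).bind fun _ =>
    (Frag.act fun c => ⟨Function.update c .input (w.getD (c .input)), .stay, c .input⟩).bind home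

/-- Reading and writing happen in a single instruction, so every intermediate tape shows either the
old or the new array. -/
theorem exec_access {K : ℕ} (hK : 0 < K) (w : Option Bool) (A : ℕ → Bool) (σ : ℕ → ℕ) :
    (access K w).Exec (fun c => IsStore K A c ∨
        IsStore K (Function.update A (σ 0) (w.getD (A (σ 0)))) c)
      ⟨0, store K A σ⟩ (A (σ 0))
      ⟨0, store K (Function.update A (σ 0) (w.getD (A (σ 0)))) σ⟩ := by
  refine ((exec_goto hK).mono fun c => Or.inl).bind (Exec.bind (e := A (σ 0))
    (m' := ⟨K * σ 0, store K (Function.update A (σ 0) (w.getD (A (σ 0)))) σ⟩) ?_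
    ((exec_home_store _).mono fun c => Or.inr))
  rw [add_zero]
  refine exec_act_of_eq rfl (Or.inl (isStore_store K A σ)) (store_input hK (σ := σ)) rfl fun t n => ?_
  rw [← store_put_input hK]
  simp only [store_input hK]
  by_cases hn : n = K * σ 0
  · subst hn
    cases t <;> simp
  · cases t <;> simp [hn]

open Filter in
/-- One step can be carried out by a fragment. -/
theorem eventually_exists_frag : ∀ᶠ K in atTop, ∃ F : Frag (Option Unit), ∀ A σ, ∃ σ',
    F.Exec (fun c => IsStore K A c ∨ IsStore K (M.array (M.dec (σ 1)) A) c)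
      ⟨0, store K A σ⟩ none ⟨0, store K (M.array (M.dec (σ 1)) A) σ'⟩ ∧
    M.dec (σ' 1) = M.next (M.dec (σ 1)) (A (M.addr (M.dec (σ 1)))) := by
  filter_upwards [M.eventually_prepare, M.eventually_finish, eventually_gt_atTop 2] with K h1 h2 hK
  obtain ⟨F1, hF1⟩ := h1
  choose F2 hF2 using h2
  refine ⟨F1.bind fun _ => (fetch K).bind fun w => (access K w).bind fun b => (F2 b).bind fun _ =>
    move .stay none, fun A σ => ?_⟩
  obtain ⟨σ1, r1, a1, b1, c1⟩ := hF1 σ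
  obtain ⟨σ2, r2, a2, b2⟩ := exists_reg_fetch hK c1
  obtain ⟨σ3, r3, a3⟩ := hF2 (A (M.addr (M.dec (σ 1)))) σ2
  have r := exec_access (K := K) (by omega) (M.write (M.dec (σ 1))) A σ2
  rw [a2, a1] at r
  refine ⟨σ3, ((r1 A).mono fun c => Or.inl).bind (((r2 A).mono fun c => Or.inl).bind
    (r.bind (((r3 _).bind (reg_stay none _)).mono fun c => Or.inr))), ?_⟩
  rw [a3, b2, b1]

end Ctl

end InfiniteTime

/-! ### Limit stages and transfinite runs of a fragment. -/

namespace InfiniteTime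

open Frag Filter
open scoped Ordinal

/-- The values at stages below `l` for which `P` holds are unbounded. -/
def UnboundedBelow (l : Ordinal.{0}) (P : Ordinal.{0} → Prop) : Prop :=
  ∀ β < l, ∃ γ < l, β ≤ γ ∧ P γ

theorem unboundedBelow_add_omega0 {γ : Ordinal.{0}} {P : Ordinal.{0} → Prop} :
    UnboundedBelow (γ + ω) P ↔ ∃ᶠ n : ℕ in atTop, P (γ + n) := by
  rw [frequently_atTop]
  constructor
  · intro h n
    obtain ⟨δ, h1, h2, h3⟩ := h (γ + n) (by simp [Ordinal.natCast_lt_omega0])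
    obtain ⟨ε, rfl⟩ := exists_add_of_le (le_self_add.trans h2)
    rw [add_lt_add_iff_left, Ordinal.lt_omega0] at h1
    obtain ⟨m, rfl⟩ := h1
    rw [add_le_add_iff_left, Nat.cast_le] at h2
    exact ⟨m, h2, h3⟩
  · intro h β hβ
    obtain ⟨d, hd, hd2⟩ := (Ordinal.lt_add_iff Ordinal.omega0_ne_zero).1 hβ
    obtain ⟨n, rfl⟩ := Ordinal.lt_omega0.1 hd
    obtain ⟨m, h1, h2⟩ := h n
    exact ⟨γ + m, by simp [Ordinal.natCast_lt_omega0], hd2.trans (by simpa using h1), h2⟩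

/-- Division by `c` splits a stage below `c * l` into the number of its block and a position in the
block. At a limit of blocks it therefore only matters in which blocks `P` occurs. -/
theorem unboundedBelow_mul {c l : Ordinal.{0}} (hc : c ≠ 0) (hl : Order.IsSuccLimit l)
    {P : Ordinal.{0} → Prop} :
    UnboundedBelow (c * l) P ↔
      ∀ α < l, ∃ α' < l, α ≤ α' ∧ ∃ δ < c, P (c * α' + δ) := by
  have hc0 : 0 < c := pos_iff_ne_zero.2 hc
  constructor
  · intro h α hα
    obtain ⟨γ, h1, h2, h3⟩ := h (c * α) (by gcongr)
    refine ⟨γ / c, (Ordinal.lt_mul_iff_div_lt hc).1 h1, (Ordinal.mul_le_iff_le_div hc).1 h2, γ % c,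
      Ordinal.mod_lt _ hc, ?_⟩
    rwa [Ordinal.div_add_mod]
  · intro h β hβ
    have h1 := (Ordinal.lt_mul_iff_div_lt hc).1 hβ
    -- The occurrence in the block of `β` could come before `β`, so the next block is used; it is
    -- still below `l`, a limit.
    obtain ⟨α', h2, h3, δ, h4, h5⟩ := h (β / c + 1) (by
      have := hl.succ_lt h1
      rwa [Order.succ_eq_add_one] at this)
    refine ⟨c * α' + δ, ?_, ?_, h5⟩
    · have h6 := hl.succ_lt h2
      rw [Order.succ_eq_add_one] at h6
      calc c * α' + δ < c * α' + c := by gcongr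
        _ = c * (α' + 1) := (mul_add_one ..).symm
        _ ≤ c * l := by gcongr
    · calc β ≤ c * (β / c) + c := (Ordinal.lt_mul_div_add β hc).le
        _ = c * (β / c + 1) := (mul_add_one ..).symm
        _ ≤ c * α' := by gcongr
        _ ≤ _ := le_self_add

namespace Program

variable (p : Program) (x : Real2)

theorem run_zero : p.run x 0 = p.init x := Ordinal.limitRecOn_zero ..

theorem run_add_one (α : Ordinal.{0}) : p.run x (α + 1) = p.step (p.run x α) :=
  Ordinal.limitRecOn_add_one ..

theorem run_limit {l : Ordinal.{0}} (hl : Order.IsSuccLimit l) :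
    p.run x l = p.limitConfig l fun γ _ => p.run x γ :=
  Ordinal.limitRecOn_limit _ _ _ _ hl

theorem run_add_nat (α : Ordinal.{0}) (n : ℕ) : p.run x (α + n) = p.step^[n] (p.run x α) := by
  induction n with
  | zero => simp
  | succ n ih =>
    rw [Nat.cast_succ, ← add_assoc, run_add_one, ih, Function.iterate_succ_apply']

theorem run_limit_cell {l : Ordinal.{0}} (hl : Order.IsSuccLimit l) (t : Tape) (n : ℕ) :
    (p.run x l).cell t n = true ↔ UnboundedBelow l fun γ => (p.run x γ).cell t n = true := by
  rw [run_limit p x hl]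
  simp [limitConfig, UnboundedBelow, and_left_comm]

theorem run_limit_state {l : Ordinal.{0}} (hl : Order.IsSuccLimit l) :
    (p.run x l).state = p.limit := by
  rw [run_limit p x hl]; rfl

theorem run_limit_head {l : Ordinal.{0}} (hl : Order.IsSuccLimit l) : (p.run x l).head = 0 := by
  rw [run_limit p x hl]; rfl

/-- The program that runs a fragment from its entry at the beginning and at each limit. -/
def ofFrag (F : Frag Unit) : Program where
  State := Option (F.Q ⊕ Unit)
  finite_state := by
    have := F.finite
    infer_instance
  start := none
  limit := some (.inl F.entry)
  halt := some (.inr ())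
  start_ne_limit := by simp
  start_ne_halt := by simp
  limit_ne_halt := by simp
  instr := fun q c => match q with
    | none => (F.instr F.entry c).map some
    | some (.inl q) => (F.instr q c).map some
    | some (.inr ()) => ⟨c, .stay, none⟩

/-- The configuration of `ofFrag F` with a given state and memory. -/
def ofFragConfig (F : Frag Unit) (s : F.Q ⊕ Unit) (m : Memory) : Config (ofFrag F).State :=
  ⟨some s, m.head, m.cell⟩

theorem step_ofFragConfig (F : Frag Unit) (q : F.Q) (m : Memory) :
    (ofFrag F).step (ofFragConfig F (.inl q) m) =
      ofFragConfig F (F.instr q m.column).next (m.act (F.instr q m.column)) := rfl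

/-- A path in a fragment is a run of the program. -/
theorem _root_.InfiniteTime.Frag.Path.iterate {F : Frag Unit} {P : Cells → Prop} {q m s m'}
    (H : F.Path P q m s m') : ∃ k, 0 < k ∧
      (ofFrag F).step^[k] (ofFragConfig F (.inl q) m) = ofFragConfig F s m' ∧
      ∀ j < k, ((ofFrag F).step^[j] (ofFragConfig F (.inl q) m)).state ≠ (ofFrag F).halt ∧
        P ((ofFrag F).step^[j] (ofFragConfig F (.inl q) m)).cell := by
  induction H with
  | single h1 =>
    refine ⟨1, one_pos, rfl, fun j hj => ?_⟩
    obtain rfl : j = 0 := by omega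
    exact ⟨by simp [ofFragConfig, ofFrag], h1⟩
  | @cons q m q' s m' h1 h2 _ ih =>
    obtain ⟨k, _, h3, h4⟩ := ih
    have h5 := step_ofFragConfig F q m
    rw [h2] at h5
    refine ⟨k + 1, by omega, by rw [Function.iterate_succ_apply, h5, h3], fun j hj => ?_⟩
    cases j with
    | zero => exact ⟨by simp [ofFragConfig, ofFrag], h1⟩
    | succ j =>
      rw [Function.iterate_succ_apply, h5]
      exact h4 j (by omega)

/-- Start and limit state have to differ, so the start state is a copy of the entry with the same
instructions; the two runs agree after one step, and a path has at least one. -/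
theorem _root_.InfiniteTime.Frag.Path.iterate_entry {F : Frag Unit} {P : Cells → Prop} {h c s m'}
    (H : F.Path P F.entry ⟨h, c⟩ s m') {q : (ofFrag F).State}
    (hq : q = (ofFrag F).start ∨ q = (ofFrag F).limit) : ∃ k, 0 < k ∧
      (ofFrag F).step^[k] ⟨q, h, c⟩ = ofFragConfig F s m' ∧
      ∀ j < k, ((ofFrag F).step^[j] ⟨q, h, c⟩).state ≠ (ofFrag F).halt ∧
        P ((ofFrag F).step^[j] ⟨q, h, c⟩).cell := by
  obtain ⟨k, h1, h2, h3⟩ := H.iterate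
  rcases hq with rfl | rfl
  · refine ⟨k, h1, ?_, fun j hj => ?_⟩
    · obtain ⟨k, rfl⟩ := Nat.exists_eq_succ_of_ne_zero h1.ne'
      exact h2
    · cases j with
      | zero => exact ⟨(ofFrag F).start_ne_halt, (h3 0 hj).2⟩
      | succ j => exact h3 (j + 1) hj
  · exact ⟨k, h1, h2, h3⟩

end Program

/-- The times at which a chain of configurations is passed. -/
theorem exists_times {C : Type*} {f : C → C} {c : ℕ → C} {S : ℕ → C → Prop}
    (h : ∀ n, ∃ k, 0 < k ∧ f^[k] (c n) = c (n + 1) ∧ ∀ j < k, S n (f^[j] (c n))) :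
    ∃ ρ θ : ℕ → ℕ, Tendsto ρ atTop atTop ∧ (∀ t, S (ρ t) (f^[t] (c 0))) ∧ (∀ n, n ≤ θ n) ∧
      ∀ n, f^[θ n] (c 0) = c n := by
  choose k hk0 hk hS using h
  let θ : ℕ → ℕ := fun n => ∑ i ∈ Finset.range n, k i
  have hθ : ∀ n, θ (n + 1) = θ n + k n := fun n => Finset.sum_range_succ ..
  have hθm : StrictMono θ := strictMono_nat_of_lt_succ fun n => by
    have := hk0 n
    have := hθ n
    omega
  have hc : ∀ n, f^[θ n] (c 0) = c n := by
    intro n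
    induction n with
    | zero => rfl
    | succ n ih => rw [hθ, add_comm, Function.iterate_add_apply, ih, hk]
  have hex : ∀ t, ∃ n, θ n ≤ t ∧ t < θ (n + 1) := by
    intro t
    induction t with
    | zero => exact ⟨0, le_rfl, hθm one_pos⟩
    | succ t ih =>
      obtain ⟨n, h1, h2⟩ := ih
      by_cases h3 : t + 1 < θ (n + 1)
      · exact ⟨n, by omega, h3⟩
      · exact ⟨n + 1, by omega, by have := hθm (Nat.lt_add_one (n + 1)); omega⟩
  -- `ρ t` is the link of the chain during which time `t` falls.
  choose ρ hρ1 hρ2 using hex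
  refine ⟨ρ, θ, ?_, fun t => ?_, fun n => hθm.le_apply, hc⟩
  · refine tendsto_atTop.2 fun b => ?_
    filter_upwards [eventually_ge_atTop (θ b)] with t ht
    by_contra hb
    have : θ (ρ t + 1) ≤ θ b := hθm.monotone (by omega)
    have := hρ2 t
    omega
  · have h1 := hρ1 t
    have h2 := hρ2 t
    rw [hθ] at h2
    have := hS (ρ t) (t - θ (ρ t)) (by omega)
    rwa [← hc, ← Function.iterate_add_apply, Nat.sub_add_cancel h1] at this

end InfiniteTime

/-! ### The clearing phase and the main phase, each of length `ω`. -/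

namespace InfiniteTime

open Frag Filter

/-- Change one cell. -/
abbrev Cells.set (c : Cells) (t : Tape) (n : ℕ) (b : Bool) : Cells :=
  Function.update c t (Function.update (c t) n b)

/-- What is done at each limit stage depends on the first bit of the input tape and on the second
bit of the output tape: halt (`none`), resume the main loop (`some true`), or clear the scratch tape
(`some false`). -/
def dispatch : Frag (Option Bool) :=
  (act fun c => ⟨Function.update c .output true, .right, c .input⟩).bind fun b =>
    act fun c => match b, c .output with
      | true, false => ⟨c, .left, none⟩
      | false, true => ⟨Function.update c .output false, .left, some true⟩
      | _, _ => ⟨Function.update c .output true, .left, some false⟩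

/-- The limit state is always the same, so the two flags must tell what kind of limit it is. Input
bit and output bit are `0, 0` at the start and after a main phase that lowered its flag, `0, 1`
after a clearing phase, and `1, 1` at a limit of blocks, since each block raises both. The pair `1,
0` is left for a main phase whose flag survived, and means halting. -/
theorem exec_dispatch {P : Cells → Prop} {c c' : Cells} {e : Option Bool}
    (h0 : P c) (h1 : P (c.set .output 0 true))
    (he : e = if c .input 0 = c .output 1 then some false else
      if c .output 1 = true then some true else none)
    (hc : c' = (c.set .output 0 true).set .output 1
      (if c .input 0 = c .output 1 then true else false)) :
    dispatch.Exec P ⟨0, c⟩ e ⟨0, c'⟩ := by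
  subst hc
  refine Exec.bind (e := c .input 0) (m' := ⟨1, c.set .output 0 true⟩) ?_ ?_
  · refine exec_act_of_eq rfl h0 rfl rfl fun t n => ?_
    by_cases hn : n = 0
    · subst hn
      cases t <;> simp
    · cases t <;> simp [hn]
  · rcases hi : c .input 0 <;> rcases ho : c .output 1 <;> rw [hi, ho] at he <;> subst he
    all_goals
      refine exec_act_of_eq (by simp only [Function.update_self, Function.update_of_ne, ne_eq,
        one_ne_zero, not_false_eq_true, ho]; rfl) h1 rfl rfl fun t n => ?_
      by_cases hn : n = 1
      · subst hn
        cases t <;> simp [ho]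
      · cases t <;> simp [hn]

/-- Clear the scratch tape forever. -/
def sweep : Frag Unit := loop (act fun c => ⟨Function.update c .scratch false, .right, none⟩)

/-- What is done after `dispatch`. -/
def branch (F : Frag (Option Unit)) : Option Bool → Frag Unit
  | none => move .stay ()
  | some true => (put .input true).bind fun _ => loop F
  | some false => (put .input false).bind fun _ => sweep

/-- Run the main loop `F` and the clearing loop in turns. -/
def supervise (F : Frag (Option Unit)) : Frag Unit := dispatch.bind (branch F)

/-- The entry of the main loop. -/
def mainState (F : Frag (Option Unit)) : (supervise F).Q := .inr ⟨some true, .inr ⟨(), F.entry⟩⟩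

/-- The entry of the clearing loop. -/
def sweepState (F : Frag (Option Unit)) : (supervise F).Q := .inr ⟨some false, .inr ⟨(), ()⟩⟩

section

variable {F : Frag (Option Unit)} {P : Cells → Prop}

theorem path_mainState {m m' m'' : Memory} (h : dispatch.Exec P m (some true) m')
    (h' : (put .input true).Exec P m' () m'') :
    (supervise F).Path P (supervise F).entry m (.inl (mainState F)) m'' :=
  Frag.Path.trans (Frag.Path.bind_left (branch F) h) (Frag.Path.bind_right _ (branch F) (some true)
    (Frag.Path.bind_left (fun _ => loop F) h'))

theorem path_sweepState {m m' m'' : Memory} (h : dispatch.Exec P m (some false) m')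
    (h' : (put .input false).Exec P m' () m'') :
    (supervise F).Path P (supervise F).entry m (.inl (sweepState F)) m'' :=
  Frag.Path.trans (Frag.Path.bind_left (branch F) h) (Frag.Path.bind_right _ (branch F) (some false)
    (Frag.Path.bind_left (fun _ => sweep) h'))

theorem path_exit {m m' : Memory} (h : dispatch.Exec P m none m') (hP : P m'.cell) :
    (supervise F).Path P (supervise F).entry m (.inr ()) m' :=
  Exec.bind (G := branch F) h (exec_move .stay () hP)

theorem path_mainState_mainState {m m' : Memory} (h : F.Exec P m none m') :
    (supervise F).Path P (mainState F) m (.inl (mainState F)) m' :=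
  Frag.Path.bind_right dispatch (branch F) (some true)
    (Frag.Path.bind_right (put .input true) (fun _ => loop F) () (Frag.Path.loop h))

theorem path_sweepState_sweepState {n : ℕ} {c : Cells} (h : P c) :
    (supervise F).Path P (sweepState F) ⟨n, c⟩ (.inl (sweepState F))
      ⟨n + 1, c.set .scratch n false⟩ := by
  refine Frag.Path.bind_right dispatch (branch F) (some false)
    (Frag.Path.bind_right (put .input false) (fun _ => sweep) ()
      (Frag.Path.loop (s := .inr none) ?_))
  refine exec_act_of_eq rfl h rfl rfl fun t k => ?_
  by_cases hn : k = n
  · subst hn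
    cases t <;> simp
  · cases t <;> simp [hn]

end

open Program

/-- The clearing phase. -/
theorem clear_phase (F : Frag (Option Unit)) {q : (ofFrag (supervise F)).State}
    (hq : q = (ofFrag (supervise F)).start ∨ q = (ofFrag (supervise F)).limit) {c : Cells}
    (hc : c .input 0 = c .output 1) :
    (∀ t, ((ofFrag (supervise F)).step^[t] ⟨q, 0, c⟩).state ≠ (ofFrag (supervise F)).halt ∧
      (∀ n ≠ 0, ((ofFrag (supervise F)).step^[t] ⟨q, 0, c⟩).cell .input n = c .input n) ∧
      ∀ n ≥ 2, ((ofFrag (supervise F)).step^[t] ⟨q, 0, c⟩).cell .output n = c .output n) ∧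
    ∀ n, ∀ᶠ t in atTop,
      ((ofFrag (supervise F)).step^[t] ⟨q, 0, c⟩).cell .input 0 = false ∧
      ((ofFrag (supervise F)).step^[t] ⟨q, 0, c⟩).cell .scratch n = false ∧
      ((ofFrag (supervise F)).step^[t] ⟨q, 0, c⟩).cell .output 0 = true ∧
      ((ofFrag (supervise F)).step^[t] ⟨q, 0, c⟩).cell .output 1 = true := by
  set c2 : Cells := ((c.set .output 0 true).set .output 1 true).set .input 0 false with hc2
  let D : ℕ → Memory := fun n => ⟨n, fun t k => if t = .scratch ∧ k < n then false else c2 t k⟩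
  -- Link `0` covers the dispatch, and link `n + 1` starts with the head on cell `n` and all scratch
  -- cells before it cleared; hence the shift `k + 1 < n` in `S`.
  let C : ℕ → Config (ofFrag (supervise F)).State := fun n => Nat.casesOn n ⟨q, 0, c⟩
    fun n => ofFragConfig (supervise F) (.inl (sweepState F)) (D n)
  let S : ℕ → Config (ofFrag (supervise F)).State → Prop := fun n x =>
    x.state ≠ (ofFrag (supervise F)).halt ∧ ((∀ k ≠ 0, x.cell .input k = c .input k) ∧
      (∀ k ≥ 2, x.cell .output k = c .output k)) ∧
      (n ≠ 0 → x.cell .input 0 = false ∧ (∀ k, k + 1 < n → x.cell .scratch k = false) ∧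
        x.cell .output 0 = true ∧ x.cell .output 1 = true)
  have hCS : ∀ n, ∃ k, 0 < k ∧ (ofFrag (supervise F)).step^[k] (C n) = C (n + 1) ∧
      ∀ j < k, S n ((ofFrag (supervise F)).step^[j] (C n)) := by
    intro n
    cases n with
    | zero =>
      have h1 : dispatch.Exec (fun x => (∀ k ≠ 0, x .input k = c .input k) ∧
          ∀ k ≥ 2, x .output k = c .output k) ⟨0, c⟩ (some false)
          ⟨0, (c.set .output 0 true).set .output 1 true⟩ := by
        refine exec_dispatch ⟨fun _ _ => rfl, fun _ _ => rfl⟩ ⟨fun k hk => by simp,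
          fun k hk => ?_⟩ (by simp [hc]) (by simp [hc])
        have : k ≠ 0 := by omega
        simp [this]
      obtain ⟨k, hk, hk1, hk2⟩ := Path.iterate_entry (path_sweepState (F := F) h1
        (exec_put .input false ⟨fun k hk => by simp, fun k hk => by
          have h0 : k ≠ 0 := by omega
          have h1 : k ≠ 1 := by omega
          simp [h0, h1]⟩)) hq
      refine ⟨k, hk, ?_, fun j hj => ⟨(hk2 j hj).1, (hk2 j hj).2, fun h => absurd rfl h⟩⟩
      rw [show C 0 = ⟨q, 0, c⟩ from rfl, hk1]
      simp [C, D, hc2]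
      rfl
    | succ n =>
      obtain ⟨k, hk, hk1, hk2⟩ := Path.iterate (path_sweepState_sweepState (F := F) (n := n)
        (c := (D n).cell) (P := fun x => x = (D n).cell) rfl)
      refine ⟨k, hk, hk1.trans ?_, fun j hj => ⟨(hk2 j hj).1, ?_⟩⟩
      · simp only [C]
        congr 1
        simp only [D, Memory.mk.injEq, true_and]
        funext t i
        by_cases ht : t = .scratch
        · subst ht
          by_cases hi : i = n
          · subst hi; simp
          · have : i < n + 1 ↔ i < n := by omega
            simp [hi, this]
        · simp [ht]
      · rw [show C (n + 1) = ofFragConfig (supervise F) (.inl (sweepState F)) ⟨n, (D n).cell⟩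
          from rfl, (hk2 j hj).2]
        refine ⟨⟨fun k hk => by simp [D, hc2, hk], fun k hk => ?_⟩, fun _ => ⟨by simp [D, hc2],
          fun k hk => ?_, by simp [D, hc2], by simp [D, hc2]⟩⟩
        · have h0 : k ≠ 0 := by omega
          have h1 : k ≠ 1 := by omega
          simp [D, hc2, h0, h1]
        · have : k < n := by omega
          simp [D, this]
  obtain ⟨ρ, θ, hρ, hS, -, -⟩ := exists_times hCS
  refine ⟨fun t => ⟨(hS t).1, (hS t).2.1⟩, fun n => ?_⟩
  filter_upwards [hρ.eventually_gt_atTop (n + 1)] with t ht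
  obtain ⟨-, -, h⟩ := hS t
  obtain ⟨h1, h2, h3⟩ := h (by omega)
  exact ⟨h1, h2 n ht, h3⟩

/-- The input tape that holds an array. -/
def inputOf (K : ℕ) (A : ℕ → Bool) : ℕ → Bool := fun n => if n % K = 0 then A (n / K) else false

namespace Ctl

variable {X : Type} [Primcodable X] (M : Ctl X)

/-- The array after `m` steps, if the machine starts with the array `A`, with a `1` written at the
first place. -/
def block (A : ℕ → Bool) (m : ℕ) : ℕ → Bool :=
  (M.step^[m] (M.init, Function.update A 0 true)).2

/-- The fragment simulates one step. -/
def Simulates (K : ℕ) (F : Frag (Option Unit)) : Prop :=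
  ∀ A σ, ∃ σ', F.Exec (fun c => IsStore K A c ∨ IsStore K (M.array (M.dec (σ 1)) A) c)
      ⟨0, store K A σ⟩ none ⟨0, store K (M.array (M.dec (σ 1)) A) σ'⟩ ∧
    M.dec (σ' 1) = M.next (M.dec (σ 1)) (A (M.addr (M.dec (σ 1))))

/-- The main phase. -/
theorem main_phase {K : ℕ} (hK : 0 < K) {F : Frag (Option Unit)} (hF : M.Simulates K F) {c : Cells}
    {A : ℕ → Bool} (hA : A 0 = false) (hi : c .input = inputOf K A)
    (hs : ∀ n, c .scratch n = false) (ho : ∀ n, c .output n = decide (n < 2)) :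
    (∀ t, ((ofFrag (supervise F)).step^[t] ⟨(ofFrag (supervise F)).limit, 0, c⟩).state ≠
          (ofFrag (supervise F)).halt ∧
        (((ofFrag (supervise F)).step^[t] ⟨(ofFrag (supervise F)).limit, 0, c⟩).cell .input =
            inputOf K A ∨ ∃ m,
          ((ofFrag (supervise F)).step^[t] ⟨(ofFrag (supervise F)).limit, 0, c⟩).cell .input =
            inputOf K (M.block A m)) ∧
        ∀ n ≥ 2, ((ofFrag (supervise F)).step^[t] ⟨(ofFrag (supervise F)).limit, 0, c⟩).cell
          .output n = false) ∧
      (∀ m, ∃ t ≥ m,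
        ((ofFrag (supervise F)).step^[t] ⟨(ofFrag (supervise F)).limit, 0, c⟩).cell .input =
          inputOf K (M.block A m)) ∧
      ∀ N, ∀ᶠ t in atTop, (∃ m ≥ N,
        ((ofFrag (supervise F)).step^[t] ⟨(ofFrag (supervise F)).limit, 0, c⟩).cell .input =
          inputOf K (M.block A m)) ∧
        ∀ n, ((ofFrag (supervise F)).step^[t] ⟨(ofFrag (supervise F)).limit, 0, c⟩).cell
          .output n = decide (n = 0) := by
  choose next hnext using hF
  -- Array and registers after `m` simulated steps. The registers start at `0`, which decodes to
  -- `M.init`.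
  let s : ℕ → (ℕ → Bool) × (ℕ → ℕ) := fun m => Nat.rec (Function.update A 0 true, fun _ => 0)
    (fun _ r => (M.array (M.dec (r.2 1)) r.1, next r.1 r.2)) m
  have hs1 : ∀ m, M.step^[m] (M.init, Function.update A 0 true) =
      (M.dec ((s m).2 1), (s m).1) := by
    intro m
    induction m with
    | zero => rfl
    | succ m ih =>
      rw [Function.iterate_succ_apply', ih]
      exact Prod.ext (hnext _ _).2.symm rfl
  have hb : ∀ m, M.block A m = (s m).1 := fun m => by rw [block, hs1]
  let C : ℕ → Config (ofFrag (supervise F)).State := fun n => Nat.casesOn n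
    ⟨(ofFrag (supervise F)).limit, 0, c⟩
    fun n => ofFragConfig (supervise F) (.inl (mainState F)) ⟨0, store K (s n).1 (s n).2⟩
  -- While simulated step `n - 1` is carried out, the array visible is the one before or after that
  -- step, so its number `m` satisfies `n ≤ m + 1`.
  let S : ℕ → Config (ofFrag (supervise F)).State → Prop := fun n x =>
    x.state ≠ (ofFrag (supervise F)).halt ∧ ((n = 0 ∧ x.cell .input = inputOf K A ∧
      ∀ k ≥ 2, x.cell .output k = false) ∨ (n ≠ 0 ∧ (∃ m, n ≤ m + 1 ∧
        x.cell .input = inputOf K (M.block A m)) ∧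
        ∀ k, x.cell .output k = decide (k = 0)))
  have hCS : ∀ n, ∃ k, 0 < k ∧ (ofFrag (supervise F)).step^[k] (C n) = C (n + 1) ∧
      ∀ j < k, S n ((ofFrag (supervise F)).step^[j] (C n)) := by
    intro n
    cases n with
    | zero =>
      have hi0 : c .input 0 = false := by rw [hi]; simp [inputOf, hA]
      have hi1 : c .output 1 = true := by rw [ho]; rfl
      have h1 : dispatch.Exec (fun x => x .input = inputOf K A ∧ ∀ k ≥ 2, x .output k = false)
          ⟨0, c⟩ (some true) ⟨0, (c.set .output 0 true).set .output 1 false⟩ := by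
        refine exec_dispatch ⟨hi, fun k hk => ?_⟩ ⟨by simp [hi], fun k hk => ?_⟩ (by simp [hi0, hi1])
          (by simp [hi0, hi1])
        · rw [ho]; simp; omega
        · have : k ≠ 0 := by omega
          simp only [Function.update_self, ne_eq, this, not_false_eq_true, Function.update_of_ne, ho,
            decide_eq_false_iff_not]
          omega
      obtain ⟨k, hk, hk1, hk2⟩ := Path.iterate_entry (path_mainState (F := F) h1
        (exec_put .input true ⟨by simp [hi], fun k hk => by
          have h0 : k ≠ 0 := by omega
          have h1 : k ≠ 1 := by omega
          simp [h0, h1, ho]; omega⟩)) (Or.inr rfl)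
      refine ⟨k, hk, hk1.trans ?_, fun j hj => ⟨(hk2 j hj).1, Or.inl ⟨rfl, (hk2 j hj).2⟩⟩⟩
      simp only [C]
      congr 2
      rw [show s 0 = (Function.update A 0 true, fun _ => 0) from rfl, ← store_put_input hK, mul_zero]
      funext t n
      cases t
      · simp only [Function.update_self, ne_eq, reduceCtorEq, not_false_eq_true,
          Function.update_of_ne, hi]
        rfl
      · simp [hs, store]
      · by_cases h0 : n = 0
        · simp [store, h0]
        · by_cases h1 : n = 1
          · simp [store, h1]
          · simp [store, h0, h1, ho]; omega
    | succ n =>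
      obtain ⟨k, hk, hk1, hk2⟩ := Path.iterate (path_mainState_mainState (F := F)
        (hnext (s n).1 (s n).2).1)
      refine ⟨k, hk, hk1, fun j hj => ⟨(hk2 j hj).1, Or.inr ⟨by omega, ?_, fun i => ?_⟩⟩⟩
      · rcases (hk2 j hj).2 with ⟨σ, h⟩ | ⟨σ, h⟩
        · exact ⟨n, le_rfl, by rw [hb]; exact congrFun h _⟩
        · exact ⟨n + 1, by omega, by rw [hb]; exact congrFun h _⟩
      · rcases (hk2 j hj).2 with ⟨σ, h⟩ | ⟨σ, h⟩ <;> exact congrFun (congrFun h .output) i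
  obtain ⟨ρ, θ, hρ, hS, hθ, hθC⟩ := exists_times hCS
  refine ⟨fun t => ⟨(hS t).1, ?_, ?_⟩, fun m => ⟨θ (m + 1), (Nat.le_succ m).trans (hθ _), ?_⟩,
    fun N => ?_⟩
  · rcases (hS t).2 with ⟨-, h, -⟩ | ⟨-, ⟨m, -, h⟩, -⟩
    · exact Or.inl h
    · exact Or.inr ⟨m, h⟩
  · rcases (hS t).2 with ⟨-, -, h⟩ | ⟨-, -, h⟩
    · exact h
    · intro n hn
      have h0 : n ≠ 0 := by omega
      exact (h n).trans (by simp [h0])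
  · rw [hb]
    exact congrFun (congrArg Config.cell (hθC (m + 1))) _
  · filter_upwards [hρ.eventually_gt_atTop N] with t ht
    rcases (hS t).2 with ⟨h, -⟩ | ⟨-, ⟨m, hm, h⟩, h'⟩
    · omega
    · exact ⟨⟨m, by omega, h⟩, h'⟩

end Ctl

end InfiniteTime

/-! ### Blocks of length `ω * 2` and the induction over blocks. -/

namespace InfiniteTime

open Frag Filter Program
open scoped Ordinal

namespace Ctl

variable {X : Type} [Primcodable X] (M : Ctl X)

/-- The configuration at the beginning of a clearing phase. -/
structure BlockStart (p : Program) (K : ℕ) (B : ℕ → Bool) (c : Config p.State) : Prop where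
  state : c.state = p.start ∨ c.state = p.limit
  head : c.head = 0
  input_of_mod : ∀ n, n % K ≠ 0 → c.cell .input n = false
  input : ∀ v ≠ 0, c.cell .input (K * v) = B v
  flags : c.cell .input 0 = c.cell .output 1
  output : ∀ n ≥ 2, c.cell .output n = false

theorem lt_omega0_mul_two {δ : Ordinal.{0}} (h : δ < ω * 2) :
    (∃ n : ℕ, δ = n) ∨ ∃ n : ℕ, δ = ω + n := by
  rw [Ordinal.mul_two] at h
  rcases lt_or_ge δ ω with h1 | h1
  · exact Or.inl (Ordinal.lt_omega0.1 h1)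
  · obtain ⟨ε, rfl⟩ := exists_add_of_le h1
    rw [add_lt_add_iff_left] at h
    obtain ⟨n, rfl⟩ := Ordinal.lt_omega0.1 h
    exact Or.inr ⟨n, rfl⟩

theorem natCast_lt_omega0_mul_two (n : ℕ) : (n : Ordinal.{0}) < ω * 2 := by
  rw [Ordinal.mul_two]
  exact (Ordinal.natCast_lt_omega0 n).trans_le le_self_add

theorem omega0_add_natCast_lt (n : ℕ) : ω + (n : Ordinal.{0}) < ω * 2 := by
  rw [Ordinal.mul_two]
  simp [Ordinal.natCast_lt_omega0]

open Classical in
/-- The array at the limit of a main phase. -/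
noncomputable def limsup (B : ℕ → Bool) (v : ℕ) : Bool :=
  decide (∃ᶠ m in atTop, M.block B m v = true)

theorem limsup_eq_true {B : ℕ → Bool} {v : ℕ} :
    M.limsup B v = true ↔ ∃ᶠ m in atTop, M.block B m v = true := by
  simp [limsup]

theorem isSuccLimit_add_omega0 (γ : Ordinal.{0}) : Order.IsSuccLimit (γ + ω) :=
  Ordinal.isSuccLimit_add γ Ordinal.isSuccLimit_omega0

theorem run_add_omega0_cell (p : Program) (x : Real2) (γ : Ordinal.{0}) (t : Tape) (n : ℕ) :
    (p.run x (γ + ω)).cell t n = true ↔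
      ∃ᶠ k in atTop, (p.step^[k] (p.run x γ)).cell t n = true := by
  rw [run_limit_cell _ _ (isSuccLimit_add_omega0 γ), unboundedBelow_add_omega0]
  simp only [run_add_nat]

theorem run_add_omega0_cell_eq (p : Program) (x : Real2) (γ : Ordinal.{0}) (t : Tape) (n : ℕ)
    (b : Bool) (h : ∀ᶠ k in atTop, (p.step^[k] (p.run x γ)).cell t n = b) :
    (p.run x (γ + ω)).cell t n = b := by
  cases b with
  | true => exact (run_add_omega0_cell ..).2 h.frequently
  | false =>
    rw [← Bool.not_eq_true, run_add_omega0_cell, not_frequently]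
    filter_upwards [h] with k hk
    simp [hk]

variable {M} {K : ℕ} {F : Frag (Option Unit)} {B : ℕ → Bool} {R : Ordinal.{0}} {x : Real2}

/-- Both kinds of limits are prepared here. The next block starts from the limsup over the main
phase, whereas a limit of blocks only sees which cells carry a `1` at some stage of a block; so the
trace records the end of the block and also everything that occurs in it. -/
theorem block_trace (hK : 0 < K) (hF : M.Simulates K F)
    (h : BlockStart (ofFrag (supervise F)) K B ((ofFrag (supervise F)).run x R)) :
    (∀ δ < ω * 2, ((ofFrag (supervise F)).run x (R + δ)).state ≠ (ofFrag (supervise F)).halt ∧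
      (∀ n, n % K ≠ 0 → ((ofFrag (supervise F)).run x (R + δ)).cell .input n = false) ∧
      ∀ n ≥ 2, ((ofFrag (supervise F)).run x (R + δ)).cell .output n = false) ∧
    (∃ δ < ω * 2, ((ofFrag (supervise F)).run x (R + δ)).cell .input 0 = true) ∧
    (∃ δ < ω * 2, ((ofFrag (supervise F)).run x (R + δ)).cell .output 0 = true) ∧
    (∃ δ < ω * 2, ((ofFrag (supervise F)).run x (R + δ)).cell .output 1 = true) ∧
    (∀ v ≠ 0, (∃ δ < ω * 2, ((ofFrag (supervise F)).run x (R + δ)).cell .input (K * v) = true) ↔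
      ∃ m, M.block B m v = true) ∧
    ((ofFrag (supervise F)).run x (R + ω * 2)).state = (ofFrag (supervise F)).limit ∧
    ((ofFrag (supervise F)).run x (R + ω * 2)).head = 0 ∧
    (((ofFrag (supervise F)).run x (R + ω * 2)).cell .input = inputOf K (M.limsup B)) ∧
    (∀ n, ((ofFrag (supervise F)).run x (R + ω * 2)).cell .output n = decide (n = 0)) := by
  obtain ⟨hst, hh, h1, h2, h3, h4⟩ := h
  set c := ((ofFrag (supervise F)).run x R).cell with hc
  have hX : (ofFrag (supervise F)).run x R = ⟨((ofFrag (supervise F)).run x R).state, 0, c⟩ := by rw [← hh]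
  obtain ⟨a1, a2⟩ := clear_phase F hst h3
  rw [← hX] at a1 a2
  -- The cell `0` is the flag: clearing writes `0` there and the main phase starts by writing `1`,
  -- so the bit `B 0` has no influence.
  set A : ℕ → Bool := Function.update B 0 false with hA
  have hAB : M.block A = M.block B := by
    funext m
    simp only [block, hA, Function.update_idem]
  have hY : (ofFrag (supervise F)).run x (R + ω) = ⟨(ofFrag (supervise F)).limit, 0, ((ofFrag (supervise F)).run x (R + ω)).cell⟩ := by
    rw [← run_limit_state _ x (isSuccLimit_add_omega0 R),
      ← run_limit_head _ x (isSuccLimit_add_omega0 R)]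
  have hin : ((ofFrag (supervise F)).run x (R + ω)).cell .input = inputOf K A := by
    funext n
    apply run_add_omega0_cell_eq
    rcases Nat.eq_zero_or_pos n with rfl | hn
    · filter_upwards [a2 0] with t ht
      rw [ht.1]
      simp [inputOf, hA]
    · refine Eventually.of_forall fun t => ?_
      rw [(a1 t).2.1 n hn.ne']
      by_cases hnK : n % K = 0
      · obtain ⟨v, rfl⟩ := Nat.dvd_of_mod_eq_zero hnK
        have hv : v ≠ 0 := by rintro rfl; simp at hn
        rw [h2 v hv]
        simp [inputOf, hA, hv, Nat.mul_div_cancel_left _ hK]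
      · rw [h1 n hnK]
        simp [inputOf, hnK]
  have hsc : ∀ n, ((ofFrag (supervise F)).run x (R + ω)).cell .scratch n = false := fun n =>
    run_add_omega0_cell_eq _ _ _ _ _ _ ((a2 n).mono fun t ht => ht.2.1)
  have hou : ∀ n, ((ofFrag (supervise F)).run x (R + ω)).cell .output n = decide (n < 2) := fun n => by
    apply run_add_omega0_cell_eq
    by_cases h : n < 2
    · filter_upwards [a2 0] with t ht
      interval_cases n
      · exact ht.2.2.1
      · exact ht.2.2.2
    · refine Eventually.of_forall fun t => ?_
      rw [(a1 t).2.2 _ (by omega), h4 _ (by omega)]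
      simp [h]
  obtain ⟨b1, b2, b3⟩ := M.main_phase hK hF (A := A) (by simp [hA]) hin hsc hou
  rw [← hY] at b1 b2 b3
  simp only [hAB] at b1 b2 b3
  have hblock0 : ∀ v ≠ 0, M.block B 0 v = B v := fun v hv => by simp [block, hv]
  have hA0 : ∀ v ≠ 0, A v = B v := fun v hv => by simp [hA, hv]
  refine ⟨fun δ hδ => ?_, ?_, ?_, ?_, fun v hv => ⟨?_, ?_⟩, ?_, ?_, ?_, ?_⟩
  · rcases lt_omega0_mul_two hδ with ⟨n, rfl⟩ | ⟨n, rfl⟩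
    · rw [run_add_nat]
      obtain ⟨g1, g2, g3⟩ := a1 n
      refine ⟨g1, fun k hk => ?_, fun k hk => ?_⟩
      · rw [g2 k (by rintro rfl; simp at hk), h1 k hk]
      · rw [g3 k hk, h4 k hk]
    · rw [← add_assoc, run_add_nat]
      obtain ⟨g1, g2, g3⟩ := b1 n
      refine ⟨g1, fun k hk => ?_, g3⟩
      rcases g2 with g2 | ⟨m, g2⟩ <;> rw [g2] <;> simp [inputOf, hk]
  · obtain ⟨t, -, ht⟩ := b2 0
    refine ⟨ω + t, omega0_add_natCast_lt t, ?_⟩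
    rw [← add_assoc, run_add_nat, ht]
    simp [inputOf, block]
  · obtain ⟨t, ht⟩ := (a2 0).exists
    exact ⟨t, natCast_lt_omega0_mul_two t, by rw [run_add_nat]; exact ht.2.2.1⟩
  · obtain ⟨t, ht⟩ := (a2 0).exists
    exact ⟨t, natCast_lt_omega0_mul_two t, by rw [run_add_nat]; exact ht.2.2.2⟩
  · rintro ⟨δ, hδ, hv1⟩
    rcases lt_omega0_mul_two hδ with ⟨n, rfl⟩ | ⟨n, rfl⟩
    · rw [run_add_nat, (a1 n).2.1 _ (by positivity), h2 v hv] at hv1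
      exact ⟨0, by rw [hblock0 v hv, hv1]⟩
    · rw [← add_assoc, run_add_nat] at hv1
      rcases (b1 n).2.1 with g2 | ⟨m, g2⟩ <;> rw [g2] at hv1 <;>
        simp [inputOf, Nat.mul_div_cancel_left _ hK] at hv1
      · exact ⟨0, by rw [hblock0 v hv, ← hA0 v hv, hv1]⟩
      · exact ⟨m, hv1⟩
  · rintro ⟨m, hm⟩
    obtain ⟨t, -, ht⟩ := b2 m
    refine ⟨ω + t, omega0_add_natCast_lt t, ?_⟩
    rw [← add_assoc, run_add_nat, ht]
    simp [inputOf, Nat.mul_div_cancel_left _ hK, hm]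
  all_goals rw [Ordinal.mul_two, ← add_assoc]
  · exact run_limit_state _ x (isSuccLimit_add_omega0 _)
  · exact run_limit_head _ x (isSuccLimit_add_omega0 _)
  · funext n
    by_cases hn : n % K = 0
    · rw [Bool.eq_iff_iff, run_add_omega0_cell]
      simp only [inputOf, hn, if_true, limsup_eq_true]
      -- The limsup over stages is the limsup over simulated steps: late stages show only late
      -- arrays, and each array is shown at a stage that is at least as late.
      rw [frequently_atTop, frequently_atTop]
      constructor
      · intro H N
        obtain ⟨T, hT⟩ := eventually_atTop.1 (b3 N)
        obtain ⟨t, ht, ht2⟩ := H T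
        obtain ⟨m, hm, hm2⟩ := (hT t ht).1
        rw [hm2] at ht2
        exact ⟨m, hm, by simpa [inputOf, hn] using ht2⟩
      · intro H T
        obtain ⟨m, hm, hm2⟩ := H T
        obtain ⟨t, ht, ht2⟩ := b2 m
        exact ⟨t, hm.trans ht, by rw [ht2]; simpa [inputOf, hn] using hm2⟩
    · apply run_add_omega0_cell_eq
      refine Eventually.of_forall fun t => ?_
      rcases (b1 t).2.1 with g2 | ⟨m, g2⟩ <;> rw [g2] <;> simp [inputOf, hn]
  · intro n
    apply run_add_omega0_cell_eq
    exact (b3 0).mono fun t ht => ht.2 n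

/-- The program stops at a limit with first input bit `1` and second output bit `0`. -/
theorem exists_takesExactly {γ : Ordinal.{0}}
    (hst : ((ofFrag (supervise F)).run x γ).state = (ofFrag (supervise F)).limit)
    (hh : ((ofFrag (supervise F)).run x γ).head = 0)
    (hi : ((ofFrag (supervise F)).run x γ).cell .input 0 = true)
    (ho : ((ofFrag (supervise F)).run x γ).cell .output 1 = false)
    (hl : ∀ β < γ, ((ofFrag (supervise F)).run x β).state ≠ (ofFrag (supervise F)).halt) :
    ∃ β, γ ≤ β ∧ (ofFrag (supervise F)).TakesExactly x β := by
  have hX : (ofFrag (supervise F)).run x γ = ⟨(ofFrag (supervise F)).limit, 0, ((ofFrag (supervise F)).run x γ).cell⟩ := by rw [← hh, ← hst]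
  obtain ⟨k, hk, hk1, hk2⟩ := Path.iterate_entry (path_exit (F := F) (P := fun _ => True)
    (exec_dispatch (c := ((ofFrag (supervise F)).run x γ).cell) (e := none) trivial trivial (by simp [hi, ho]) rfl)
    trivial) (Or.inr rfl)
  rw [← hX] at hk1 hk2
  obtain ⟨k, rfl⟩ := Nat.exists_eq_succ_of_ne_zero hk.ne'
  refine ⟨γ + k, le_self_add, fun β hβ => ?_, ?_⟩
  · rcases lt_or_ge β γ with h | h
    · exact hl β h
    · obtain ⟨ε, rfl⟩ := exists_add_of_le h
      rw [add_le_add_iff_left] at hβ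
      obtain ⟨n, rfl⟩ := Ordinal.lt_omega0.1 (hβ.trans_lt (Ordinal.natCast_lt_omega0 k))
      rw [run_add_nat]
      exact (hk2 n (by have := Nat.cast_le.1 hβ; omega)).1
  · rw [show γ + k + 1 = γ + ((k + 1 : ℕ) : Ordinal.{0}) by push_cast; rw [add_assoc], run_add_nat]
    rw [Nat.succ_eq_add_one] at hk1
    rw [hk1]
    rfl

variable (M) in
/-- An infinite time computation by a machine with random access, which is restarted at each
multiple of `ω` with the `limsup` of the array and stops when the first bit is `1` in this `limsup`,
can be carried out by a program, and takes at least as many steps. -/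
theorem exists_clockable (B : Ordinal.{0} → ℕ → Bool) (α₀ : Ordinal.{0})
    (h0 : ∀ v, B 0 v = false)
    (hs : ∀ α < α₀, ∀ v ≠ 0, B (α + 1) v = true ↔ ∃ᶠ m in atTop, M.block (B α) m v = true)
    (hl : ∀ l ≤ α₀, Order.IsSuccLimit l → ∀ v ≠ 0,
      (B l v = true ↔ ∀ α < l, ∃ α' < l, α ≤ α' ∧ ∃ m, M.block (B α') m v = true))
    (hc : ∀ α < α₀, ¬∃ᶠ m in atTop, M.block (B α) m 0 = true)
    (hfin : ∃ᶠ m in atTop, M.block (B α₀) m 0 = true) :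
    ∃ β, ω * α₀ < β ∧ Clockable β := by
  obtain ⟨K, ⟨F, hF⟩, hK⟩ := (M.eventually_exists_frag.and (eventually_gt_atTop 0)).exists
  have hF : M.Simulates K F := hF
  have h2 : (ω * 2 : Ordinal.{0}) ≠ 0 := by simp
  have key : ∀ α ≤ α₀, BlockStart (ofFrag (supervise F)) K (B α) ((ofFrag (supervise F)).run zeroReal (ω * 2 * α)) := by
    intro α
    induction α using Ordinal.limitRecOn with
    | zero =>
      intro _
      rw [mul_zero, run_zero]
      exact ⟨Or.inl rfl, rfl, fun _ _ => rfl, fun v _ => (h0 v).symm, rfl, fun _ _ => rfl⟩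
    | add_one α ih =>
      intro hα
      have hα' : α < α₀ := (lt_add_one α).trans_le hα
      obtain ⟨-, -, -, -, -, g1, g2, g3, g4⟩ := block_trace hK hF (ih hα'.le)
      rw [mul_add_one]
      refine ⟨Or.inr g1, g2, fun n hn => by rw [g3]; simp [inputOf, hn], fun v hv => ?_, ?_,
        fun n hn => ?_⟩
      · rw [g3, Bool.eq_iff_iff, hs α hα' v hv]
        simp [inputOf, Nat.mul_div_cancel_left _ hK, limsup_eq_true]
      · rw [g3, g4]
        -- Before `α₀` the flag dies in the limsup, so both flags are `0` and the next clearing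
        -- phase begins.
        have := hc α hα'
        rw [← limsup_eq_true, Bool.not_eq_true] at this
        simp [inputOf, this]
      · rw [g4]
        have : n ≠ 0 := by omega
        simp [this]
    | limit l hlim ih =>
      intro hα
      have ht := fun α (h : α < l) => block_trace hK hF (ih α h (h.le.trans hα))
      have hlim' : Order.IsSuccLimit (ω * 2 * l) :=
        Ordinal.isSuccLimit_mul_right (pos_iff_ne_zero.2 h2) hlim
      have hcell := fun t n => (run_limit_cell (ofFrag (supervise F)) zeroReal hlim' t n).trans
        (unboundedBelow_mul h2 hlim)
      have hfalse : ∀ t n, (∀ α < l, ∀ δ < ω * 2,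
          ((ofFrag (supervise F)).run zeroReal (ω * 2 * α + δ)).cell t n = false) →
          ((ofFrag (supervise F)).run zeroReal (ω * 2 * l)).cell t n = false := by
        intro t n h
        rw [← Bool.not_eq_true, hcell]
        intro H
        obtain ⟨α', h1, -, δ, h3, h4⟩ := H 0 hlim.bot_lt
        rw [h α' h1 δ h3] at h4
        exact Bool.noConfusion h4
      -- Every block raises both flags at some stage, so both are `1` at a limit of blocks; being
      -- equal, they again lead to a clearing phase.
      have hi : ((ofFrag (supervise F)).run zeroReal (ω * 2 * l)).cell .input 0 = true :=
        (hcell _ _).2 fun α hα => ⟨α, hα, le_rfl, (ht α hα).2.1⟩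
      have ho : ((ofFrag (supervise F)).run zeroReal (ω * 2 * l)).cell .output 1 = true :=
        (hcell _ _).2 fun α hα => ⟨α, hα, le_rfl, (ht α hα).2.2.2.1⟩
      refine ⟨Or.inr (run_limit_state _ _ hlim'), run_limit_head _ _ hlim', fun n hn => ?_,
        fun v hv => ?_, hi.trans ho.symm, fun n hn => ?_⟩
      · exact hfalse _ _ fun α hα δ hδ => ((ht α hα).1 δ hδ).2.1 n hn
      · rw [Bool.eq_iff_iff, hcell, hl l hα hlim v hv]
        refine forall₂_congr fun α _ => exists_congr fun α' => and_congr_right fun h' =>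
          and_congr_right fun _ => (ht α' h').2.2.2.2.1 v hv
      · exact hfalse _ _ fun α hα δ hδ => ((ht α hα).1 δ hδ).2.2 n hn
  have ht := fun α (h : α ≤ α₀) => block_trace hK hF (key α h)
  obtain ⟨-, -, -, -, -, g1, g2, g3, g4⟩ := ht α₀ le_rfl
  rw [← mul_add_one] at g1 g2 g3 g4
  have hlt : ω * α₀ < ω * 2 * (α₀ + 1) := by
    rw [mul_assoc]
    have h3 : α₀ < 2 * (α₀ + 1) := (lt_add_one α₀).trans_le (Ordinal.le_mul_right _ two_pos)
    exact mul_lt_mul_of_pos_left h3 Ordinal.omega0_pos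
  -- At the end of block `α₀` the input flag is still `1` and the output flag is `0`, the signal for
  -- halting.
  obtain ⟨β, hβ, hβ2⟩ := exists_takesExactly g1 g2
    (by rw [g3]; simpa [inputOf, limsup_eq_true] using hfin) (by rw [g4]; simp) (by
      intro β hβ
      have h1 := (Ordinal.lt_mul_iff_div_lt h2).1 hβ
      have h3 := (ht (β / (ω * 2)) (Order.lt_add_one_iff.1 h1)).1 (β % (ω * 2))
        (Ordinal.mod_lt _ h2)
      rw [Ordinal.div_add_mod] at h3
      exact h3.1)
  exact ⟨β, hlt.trans_le hβ, _, hβ2⟩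

end Ctl

end InfiniteTime

/-! ### Coded programs and the universal machine. -/

namespace InfiniteTime

open Filter
open scoped Ordinal

/-- The entry of the `i`-th table of instructions for the state `q` and three bits. It contains the
bits to be written, the movement of the head (modulo `3`) and the next state. -/
def entry (i q : ℕ) (b₀ b₁ b₂ : Bool) : ℕ :=
  ((Encodable.decode (α := List ℕ) i).getD []).getD
    (8 * q + 4 * b₀.toNat + 2 * b₁.toNat + b₂.toNat) 0

/-- A configuration of a coded program: the state, the position of the head and a memory, which
holds the three tapes (and the information whether the state `2` has occurred at the index `3`). -/
abbrev CodeConfig : Type := (ℕ × ℕ) × (ℕ → Bool)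

/-- The entry of the table that is used in a configuration. -/
def CodeConfig.entry (i : ℕ) (c : CodeConfig) : ℕ :=
  InfiniteTime.entry i c.1.1 (c.2 (4 * c.1.2)) (c.2 (4 * c.1.2 + 1)) (c.2 (4 * c.1.2 + 2))

/-- The memory after carrying out an entry of the table at the head position `h`. -/
def writeEntry (v h : ℕ) (m : ℕ → Bool) : ℕ → Bool :=
  Function.update (Function.update (Function.update (Function.update m (4 * h) (decide (v % 2 = 1)))
    (4 * h + 1) (decide (v / 2 % 2 = 1))) (4 * h + 2) (decide (v / 4 % 2 = 1))) 3
    (if v / 24 = 2 then true else m 3)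

/-- One step of the `i`-th coded program. -/
def codeStep (i : ℕ) (c : CodeConfig) : CodeConfig :=
  ((c.entry i / 24, c.1.2 + c.entry i / 8 % 3 - 1), writeEntry (c.entry i) c.1.2 c.2)

open Classical in
/-- The infinite time computation of the `i`-th coded program, with the limit state `0` and the
start state `1`. -/
noncomputable def codeRun (i : ℕ) (α : Ordinal.{0}) : CodeConfig :=
  Ordinal.limitRecOn α ((1, 0), fun _ => false) (fun _ c => codeStep i c) fun l _ c =>
    ((0, 0), fun k => decide (∀ β < l, ∃ γ, ∃ h : γ < l, β ≤ γ ∧ (c γ h).2 k = true))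

theorem codeRun_zero (i : ℕ) : codeRun i 0 = ((1, 0), fun _ => false) :=
  Ordinal.limitRecOn_zero ..

theorem codeRun_add_one (i : ℕ) (α : Ordinal.{0}) :
    codeRun i (α + 1) = codeStep i (codeRun i α) := Ordinal.limitRecOn_add_one ..

/-- State and head are reset at every limit, so only the memory has to survive from block to block.
The universal machine can thus keep states and head positions in its own control state, which is
lost at the end of a block. -/
theorem codeRun_limit_fst (i : ℕ) {l : Ordinal.{0}} (hl : Order.IsSuccLimit l) :
    (codeRun i l).1 = (0, 0) := by
  rw [codeRun, Ordinal.limitRecOn_limit _ _ _ _ hl]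

theorem codeRun_limit_snd (i : ℕ) {l : Ordinal.{0}} (hl : Order.IsSuccLimit l) (k : ℕ) :
    (codeRun i l).2 k = true ↔ UnboundedBelow l fun γ => (codeRun i γ).2 k = true := by
  rw [codeRun, Ordinal.limitRecOn_limit _ _ _ _ hl]
  simp [codeRun, UnboundedBelow, and_left_comm]

theorem codeRun_add_nat (i : ℕ) (α : Ordinal.{0}) (n : ℕ) :
    codeRun i (α + n) = (codeStep i)^[n] (codeRun i α) := by
  induction n with
  | zero => simp
  | succ n ih =>
    rw [Nat.cast_succ, ← add_assoc, codeRun_add_one, ih, Function.iterate_succ_apply']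

/-- The states of the universal machine: a program counter, a counter, some bits that have been
read, whether the simulated stage is not `0`, and the states and head positions of the simulated
programs, the most recent ones first. -/
abbrev UState : Type := ℕ × ℕ × List Bool × Bool × List (ℕ × ℕ × ℕ)

namespace UState

/-- The index of the present program. -/
def idx (x : UState) : ℕ := x.2.1.unpair.1

/-- Look up the state and head position of a program. -/
def lookup (f : Bool) (L : List (ℕ × ℕ × ℕ)) (i : ℕ) : ℕ × ℕ :=
  L.foldr (fun a s => if a.1 = i then a.2 else s) (if f = true then 0 else 1, 0)

/-- The state and head position of the present program. -/
def cur (x : UState) : ℕ × ℕ := lookup x.2.2.2.1 x.2.2.2.2 x.idx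

/-- The entry of the table that is used by the present program. -/
def val (x : UState) : ℕ :=
  entry x.idx x.cur.1 (x.2.2.1.getD 2 false) (x.2.2.1.getD 1 false) (x.2.2.1.getD 0 false)

/-- The place of the memory cell `k` of the program `i` in the array. -/
def place (i k : ℕ) : ℕ := Nat.pair i k + 2

/-- The index to be read or written. -/
def addr (x : UState) : ℕ :=
  if x.1 = 0 then 1 else if x.1 = 7 then 1 else if x.1 = 5 then 0 else if x.1 = 6 then 0 else
  if x.1 = 1 then place x.idx 3 else if x.1 = 14 then place x.idx 3 else
  if x.1 = 2 then place x.idx (4 * x.cur.2) else if x.1 = 8 then place x.idx (4 * x.cur.2) else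
  if x.1 = 11 then place x.idx (4 * x.cur.2) else
  if x.1 = 3 then place x.idx (4 * x.cur.2 + 1) else
  if x.1 = 9 then place x.idx (4 * x.cur.2 + 1) else
  if x.1 = 12 then place x.idx (4 * x.cur.2 + 1) else place x.idx (4 * x.cur.2 + 2)

/-- The bit to be written. -/
def write (x : UState) : Option Bool :=
  if x.1 = 6 then some false else if x.1 = 7 then some true else
  if x.1 = 11 then some (decide (x.val % 2 = 1)) else
  if x.1 = 12 then some (decide (x.val / 2 % 2 = 1)) else
  if x.1 = 13 then some (decide (x.val / 4 % 2 = 1)) else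
  if x.1 = 14 then (if x.val / 24 = 2 then some true else none) else none

/-- The next state. -/
def next (x : UState) (b : Bool) : UState :=
  if x.1 = 0 then (1, x.2.1, [], b, x.2.2.2.2) else
  if x.1 = 5 then
    (if x.2.2.1.getD 3 false = false ∧ x.val / 24 = 2 then (6, x.2.1, [], x.2.2.2)
      else (1, x.2.1 + 1, [], x.2.2.2)) else
  if x.1 = 6 then (7, x.2) else
  if x.1 = 7 then (8, 0, [], x.2.2.2) else
  if x.1 = 11 then (12, x.2) else if x.1 = 12 then (13, x.2) else if x.1 = 13 then (14, x.2) else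
  if x.1 = 14 then (8, x.2.1 + 1, [], x.2.2.2.1,
    (x.idx, x.val / 24, x.cur.2 + x.val / 8 % 3 - 1) :: x.2.2.2.2) else
  (x.1 + 1, x.2.1, b :: x.2.2.1, x.2.2.2)

theorem primrec_pc : Primrec fun x : UState => x.1 := Primrec.fst

theorem primrec_idx : Primrec idx :=
  Primrec.fst.comp (Primrec.unpair.comp (Primrec.fst.comp Primrec.snd))

theorem primrec_cur : Primrec cur := by
  have hL : Primrec fun x : UState => x.2.2.2.2 :=
    Primrec.snd.comp (Primrec.snd.comp (Primrec.snd.comp Primrec.snd))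
  have hf : Primrec fun x : UState => x.2.2.2.1 :=
    Primrec.fst.comp (Primrec.snd.comp (Primrec.snd.comp Primrec.snd))
  refine Primrec.list_foldr (h := fun (x : UState) (p : (ℕ × ℕ × ℕ) × ℕ × ℕ) =>
    if p.1.1 = x.idx then p.1.2 else p.2) hL (Primrec.pair (Primrec.ite
    (Primrec.eq.comp hf (Primrec.const true)) (Primrec.const 0) (Primrec.const 1))
    (Primrec.const 0)) ?_
  exact Primrec.ite (Primrec.eq.comp (Primrec.fst.comp (Primrec.fst.comp Primrec.snd))
    (primrec_idx.comp Primrec.fst)) (Primrec.snd.comp (Primrec.fst.comp Primrec.snd))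
    (Primrec.snd.comp Primrec.snd)

theorem primrec_bits (n : ℕ) : Primrec fun x : UState => x.2.2.1.getD n false :=
  (Primrec.list_getD false).comp (Primrec.fst.comp (Primrec.snd.comp Primrec.snd))
    (Primrec.const n)

theorem primrec_val : Primrec val := by
  have hb : ∀ n, Primrec fun x : UState => (x.2.2.1.getD n false).toNat := fun n =>
    (Primrec.dom_bool Bool.toNat).comp (primrec_bits n)
  have hm : Primrec₂ fun a b : ℕ => a * b := Primrec.nat_mul
  have ha : Primrec₂ fun a b : ℕ => a + b := Primrec.nat_add
  refine (Primrec.list_getD 0).comp (Primrec.option_getD.comp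
    (Primrec.decode.comp primrec_idx) (Primrec.const [])) ?_
  exact ha.comp (ha.comp (ha.comp (hm.comp (Primrec.const 8) (Primrec.fst.comp primrec_cur))
    (hm.comp (Primrec.const 4) (hb 2))) (hm.comp (Primrec.const 2) (hb 1))) (hb 0)

theorem primrec_addr : Primrec addr := by
  have hm : Primrec₂ fun a b : ℕ => a * b := Primrec.nat_mul
  have ha : Primrec₂ fun a b : ℕ => a + b := Primrec.nat_add
  have hpc : ∀ n, PrimrecPred fun x : UState => x.1 = n := fun n =>
    Primrec.eq.comp primrec_pc (Primrec.const n)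
  have hplace : ∀ {f : UState → ℕ}, Primrec f → Primrec fun x => place x.idx (f x) := fun hf =>
    ha.comp (Primrec₂.natPair.comp primrec_idx hf) (Primrec.const 2)
  have h0 : Primrec fun x : UState => 4 * x.cur.2 :=
    hm.comp (Primrec.const 4) (Primrec.snd.comp primrec_cur)
  have h1 := hplace (ha.comp h0 (Primrec.const 1))
  have h2 := hplace (ha.comp h0 (Primrec.const 2))
  have h3 := hplace (Primrec.const 3)
  have h0 := hplace h0
  exact Primrec.ite (hpc 0) (Primrec.const 1) <| Primrec.ite (hpc 7) (Primrec.const 1) <|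
    Primrec.ite (hpc 5) (Primrec.const 0) <| Primrec.ite (hpc 6) (Primrec.const 0) <|
    Primrec.ite (hpc 1) h3 <| Primrec.ite (hpc 14) h3 <| Primrec.ite (hpc 2) h0 <|
    Primrec.ite (hpc 8) h0 <| Primrec.ite (hpc 11) h0 <| Primrec.ite (hpc 3) h1 <|
    Primrec.ite (hpc 9) h1 <| Primrec.ite (hpc 12) h1 h2

theorem primrec_write : Primrec write := by
  have hpc : ∀ n, PrimrecPred fun x : UState => x.1 = n := fun n =>
    Primrec.eq.comp primrec_pc (Primrec.const n)
  have hb : ∀ n, Primrec fun x : UState => some (decide (x.val / n % 2 = 1)) := fun n =>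
    Primrec.option_some.comp (PrimrecPred.decide (Primrec.eq.comp (Primrec.nat_mod.comp
      (Primrec.nat_div.comp primrec_val (Primrec.const n)) (Primrec.const 2)) (Primrec.const 1)))
  have hb1 : Primrec fun x : UState => some (decide (x.val % 2 = 1)) :=
    (hb 1).of_eq fun x => by rw [Nat.div_one]
  have hh : PrimrecPred fun x : UState => x.val / 24 = 2 := Primrec.eq.comp
    (Primrec.nat_div.comp primrec_val (Primrec.const 24)) (Primrec.const 2)
  exact Primrec.ite (hpc 6) (Primrec.const _) <| Primrec.ite (hpc 7) (Primrec.const _) <|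
    Primrec.ite (hpc 11) hb1 <| Primrec.ite (hpc 12) (hb 2) <| Primrec.ite (hpc 13) (hb 4) <|
    Primrec.ite (hpc 14) (Primrec.ite hh (Primrec.const _) (Primrec.const _)) (Primrec.const _)

theorem primrec_next : Primrec₂ next := by
  have hpc : ∀ n, PrimrecPred fun x : UState × Bool => x.1.1 = n := fun n =>
    Primrec.eq.comp (primrec_pc.comp Primrec.fst) (Primrec.const n)
  have h1 : Primrec fun x : UState × Bool => x.1.2 := Primrec.snd.comp Primrec.fst
  have h2 : Primrec fun x : UState × Bool => x.1.2.2 := Primrec.snd.comp h1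
  have h3 : Primrec fun x : UState × Bool => x.1.2.2.2 := Primrec.snd.comp h2
  have hn : Primrec fun x : UState × Bool => x.1.2.1 := Primrec.fst.comp h1
  have hbits : Primrec fun x : UState × Bool => x.1.2.2.1 := Primrec.fst.comp h2
  have hL : Primrec fun x : UState × Bool => x.1.2.2.2.2 := Primrec.snd.comp h3
  have hf : Primrec fun x : UState × Bool => x.1.2.2.2.1 := Primrec.fst.comp h3
  have hn1 : Primrec fun x : UState × Bool => x.1.2.1 + 1 := Primrec.succ.comp hn
  have hv : Primrec fun x : UState × Bool => x.1.val := primrec_val.comp Primrec.fst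
  have hi : Primrec fun x : UState × Bool => x.1.idx := primrec_idx.comp Primrec.fst
  have hq : Primrec fun x : UState × Bool => x.1.val / 24 :=
    Primrec.nat_div.comp hv (Primrec.const 24)
  have hh : Primrec fun x : UState × Bool => x.1.cur.2 + x.1.val / 8 % 3 - 1 :=
    Primrec.nat_sub.comp (Primrec.nat_add.comp
      (Primrec.snd.comp (primrec_cur.comp Primrec.fst)) (Primrec.nat_mod.comp
      (Primrec.nat_div.comp hv (Primrec.const 8)) (Primrec.const 3))) (Primrec.const 1)
  have hnil : Primrec fun _ : UState × Bool => ([] : List Bool) := Primrec.const _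
  have hfound : PrimrecPred fun x : UState × Bool =>
      x.1.2.2.1.getD 3 false = false ∧ x.1.val / 24 = 2 :=
    PrimrecPred.and (Primrec.eq.comp ((primrec_bits 3).comp Primrec.fst) (Primrec.const false))
      (Primrec.eq.comp hq (Primrec.const 2))
  have hc : ∀ n : ℕ, Primrec fun _ : UState × Bool => n := fun n => Primrec.const n
  exact Primrec.ite (hpc 0) ((hc 1).pair (hn.pair (hnil.pair (Primrec.snd.pair hL)))) <|
    Primrec.ite (hpc 5) (Primrec.ite hfound ((hc 6).pair (hn.pair (hnil.pair h3)))
      ((hc 1).pair (hn1.pair (hnil.pair h3)))) <|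
    Primrec.ite (hpc 6) ((hc 7).pair h1) <|
    Primrec.ite (hpc 7) ((hc 8).pair ((hc 0).pair (hnil.pair h3))) <|
    Primrec.ite (hpc 11) ((hc 12).pair h1) <| Primrec.ite (hpc 12) ((hc 13).pair h1) <|
    Primrec.ite (hpc 13) ((hc 14).pair h1) <|
    Primrec.ite (hpc 14) ((hc 8).pair (hn1.pair (hnil.pair (hf.pair
      (Primrec.list_cons.comp (hi.pair (hq.pair hh)) hL))))) <|
    (Primrec.succ.comp (primrec_pc.comp Primrec.fst)).pair
      (hn.pair ((Primrec.list_cons.comp Primrec.snd hbits).pair h3))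

end UState

/-- The universal machine. -/
def universal : Ctl UState where
  init := (0, 0, [], false, [])
  addr := UState.addr
  write := UState.write
  next := UState.next
  primrec_addr := UState.primrec_addr
  primrec_write := UState.primrec_write
  primrec_next := UState.primrec_next

end InfiniteTime

/-! ### Correctness of single rounds of the universal machine. -/

namespace InfiniteTime

open Filter
open scoped Ordinal

namespace UState

/-- The offset `2` in `place` keeps two cells free: `0` for the search flag and `1` for the bit that
tells later blocks from the first. -/
theorem place_inj {i k i' k' : ℕ} : place i k = place i' k' ↔ i = i' ∧ k = k' := by
  simp [place, Nat.pair_eq_pair]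

theorem place_ne_zero (i k : ℕ) : place i k ≠ 0 := by simp [place]

theorem place_ne_one (i k : ℕ) : place i k ≠ 1 := by simp [place]

theorem lookup_cons (f : Bool) (L : List (ℕ × ℕ × ℕ)) (i j : ℕ) (a : ℕ × ℕ) :
    lookup f ((i, a) :: L) j = if i = j then a else lookup f L j := rfl

variable {n : ℕ} {bits : List Bool} {f : Bool} {L : List (ℕ × ℕ × ℕ)} {A : ℕ → Bool}

/-- Program counters: `0` reads the cell `1`; `1` to `5` check whether one program halts now; `6`
and `7` lower the flag and mark that the first block is over; `8` to `14` simulate one step of one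
program. Bits are stacked with the latest first, so in a check the index `3` is the bit that was
read first, the one saying that the program has halted before. -/
theorem step_init : universal.step ((0, n, bits, f, L), A) = ((1, n, [], A 1, L), A) := by
  simp [Ctl.step, Ctl.array, universal, addr, write, next]

theorem step_one : universal.step ((1, n, bits, f, L), A) =
    ((2, n, A (place n.unpair.1 3) :: bits, f, L), A) := by
  simp [Ctl.step, Ctl.array, universal, addr, write, next, idx]

theorem step_read_zero {c : ℕ} (hc : c = 2 ∨ c = 8) : universal.step ((c, n, bits, f, L), A) =
    ((c + 1, n, A (place n.unpair.1 (4 * (lookup f L n.unpair.1).2)) :: bits, f, L), A) := by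
  rcases hc with rfl | rfl <;>
  simp [Ctl.step, Ctl.array, universal, addr, write, next, idx, cur]

theorem step_read_one {c : ℕ} (hc : c = 3 ∨ c = 9) : universal.step ((c, n, bits, f, L), A) =
    ((c + 1, n, A (place n.unpair.1 (4 * (lookup f L n.unpair.1).2 + 1)) :: bits, f, L), A) := by
  rcases hc with rfl | rfl <;>
  simp [Ctl.step, Ctl.array, universal, addr, write, next, idx, cur]

theorem step_read_two {c : ℕ} (hc : c = 4 ∨ c = 10) : universal.step ((c, n, bits, f, L), A) =
    ((c + 1, n, A (place n.unpair.1 (4 * (lookup f L n.unpair.1).2 + 2)) :: bits, f, L), A) := by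
  rcases hc with rfl | rfl <;>
  simp [Ctl.step, Ctl.array, universal, addr, write, next, idx, cur]

theorem step_decide : universal.step ((5, n, bits, f, L), A) =
    (if bits.getD 3 false = false ∧ val (5, n, bits, f, L) / 24 = 2 then (6, n, [], f, L)
      else (1, n + 1, [], f, L), A) := by
  simp [Ctl.step, Ctl.array, universal, addr, write, next]

theorem step_six : universal.step ((6, n, bits, f, L), A) =
    ((7, n, bits, f, L), Function.update A 0 false) := by
  simp [Ctl.step, Ctl.array, universal, addr, write, next]

theorem step_seven : universal.step ((7, n, bits, f, L), A) =
    ((8, 0, [], f, L), Function.update A 1 true) := by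
  simp [Ctl.step, Ctl.array, universal, addr, write, next]

theorem step_eleven : universal.step ((11, n, bits, f, L), A) =
    ((12, n, bits, f, L), Function.update A (place n.unpair.1 (4 * (lookup f L n.unpair.1).2))
      (decide (val (11, n, bits, f, L) % 2 = 1))) := by
  simp [Ctl.step, Ctl.array, universal, addr, write, next, idx, cur]

theorem step_twelve : universal.step ((12, n, bits, f, L), A) =
    ((13, n, bits, f, L), Function.update A (place n.unpair.1 (4 * (lookup f L n.unpair.1).2 + 1))
      (decide (val (12, n, bits, f, L) / 2 % 2 = 1))) := by
  simp [Ctl.step, Ctl.array, universal, addr, write, next, idx, cur]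

theorem step_thirteen : universal.step ((13, n, bits, f, L), A) =
    ((14, n, bits, f, L), Function.update A (place n.unpair.1 (4 * (lookup f L n.unpair.1).2 + 2))
      (decide (val (13, n, bits, f, L) / 4 % 2 = 1))) := by
  simp [Ctl.step, Ctl.array, universal, addr, write, next, idx, cur]

theorem step_fourteen : universal.step ((14, n, bits, f, L), A) =
    ((8, n + 1, [], f, (n.unpair.1, val (14, n, bits, f, L) / 24,
        (lookup f L n.unpair.1).2 + val (14, n, bits, f, L) / 8 % 3 - 1) :: L),
      Function.update A (place n.unpair.1 3)
        (if val (14, n, bits, f, L) / 24 = 2 then true else A (place n.unpair.1 3))) := by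
  simp only [Ctl.step, Ctl.array, universal, addr, write, next, idx, cur]
  by_cases h : val (14, n, bits, f, L) / 24 = 2 <;> simp [h]

/-- The memory of the program `i`. -/
def row (A : ℕ → Bool) (i : ℕ) : ℕ → Bool := fun k => A (place i k)

/-- The configuration of the present program of the universal machine. -/
def present (n : ℕ) (f : Bool) (L : List (ℕ × ℕ × ℕ)) (A : ℕ → Bool) : CodeConfig :=
  (lookup f L n.unpair.1, row A n.unpair.1)

/-- One step of a simulated program takes seven steps. -/
theorem run_step (n : ℕ) (f : Bool) (L : List (ℕ × ℕ × ℕ)) (A : ℕ → Bool) :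
    ∃ A' : ℕ → Bool, universal.step^[7] ((8, n, [], f, L), A) = ((8, n + 1, [], f,
        (n.unpair.1, (codeStep n.unpair.1 (present n f L A)).1) :: L), A') ∧
      row A' n.unpair.1 = (codeStep n.unpair.1 (present n f L A)).2 ∧
      (∀ i ≠ n.unpair.1, row A' i = row A i) ∧ A' 0 = A 0 ∧ A' 1 = A 1 ∧
      ∀ j < 7, ∀ u, (universal.step^[j] ((8, n, [], f, L), A)).2 u = A u ∨
        (universal.step^[j] ((8, n, [], f, L), A)).2 u = A' u := by
  set i := n.unpair.1 with hi
  set h := (lookup f L i).2 with hh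
  set bs : List Bool := [A (place i (4 * h + 2)), A (place i (4 * h + 1)), A (place i (4 * h))]
  set v := (present n f L A).entry i with hv
  have hval : ∀ c, val (c, n, bs, f, L) = v := fun c => rfl
  set A1 := Function.update A (place i (4 * h)) (decide (v % 2 = 1)) with hA1
  set A2 := Function.update A1 (place i (4 * h + 1)) (decide (v / 2 % 2 = 1)) with hA2
  set A3 := Function.update A2 (place i (4 * h + 2)) (decide (v / 4 % 2 = 1)) with hA3
  set A4 := Function.update A3 (place i 3) (if v / 24 = 2 then true else A (place i 3)) with hA4
  have s1 : universal.step^[1] ((8, n, [], f, L), A) =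
      ((9, n, [A (place i (4 * h))], f, L), A) := step_read_zero (Or.inr rfl)
  have s2 : universal.step^[2] ((8, n, [], f, L), A) =
      ((10, n, [A (place i (4 * h + 1)), A (place i (4 * h))], f, L), A) := by
    rw [Function.iterate_succ_apply', s1, step_read_one (Or.inr rfl)]
  have s3 : universal.step^[3] ((8, n, [], f, L), A) = ((11, n, bs, f, L), A) := by
    rw [Function.iterate_succ_apply', s2, step_read_two (Or.inr rfl)]
  have s4 : universal.step^[4] ((8, n, [], f, L), A) = ((12, n, bs, f, L), A1) := by
    rw [Function.iterate_succ_apply', s3, step_eleven, hval]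
  have s5 : universal.step^[5] ((8, n, [], f, L), A) = ((13, n, bs, f, L), A2) := by
    rw [Function.iterate_succ_apply', s4, step_twelve, hval]
  have s6 : universal.step^[6] ((8, n, [], f, L), A) = ((14, n, bs, f, L), A3) := by
    rw [Function.iterate_succ_apply', s5, step_thirteen, hval]
  -- The index `3` is not `0`, `1` or `2` modulo `4`, hence no tape cell.
  have hA33 : A3 (place i 3) = A (place i 3) := by
    rw [hA3, Function.update_of_ne (by rw [ne_eq, place_inj]; omega), hA2,
      Function.update_of_ne (by rw [ne_eq, place_inj]; omega), hA1,
      Function.update_of_ne (by rw [ne_eq, place_inj]; omega)]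
  have s7 : universal.step^[7] ((8, n, [], f, L), A) = ((8, n + 1, [], f,
      (i, (codeStep i (present n f L A)).1) :: L), A4) := by
    rw [Function.iterate_succ_apply', s6, step_fourteen, hval, ← hi, hA33]
    rfl
  refine ⟨A4, s7, ?_, ?_, ?_, ?_, ?_⟩
  · funext k
    simp only [row, hA4, hA3, hA2, hA1, Function.update_apply, place_inj, true_and, codeStep,
      writeEntry]
    rfl
  · intro i' hi'
    funext k
    simp [row, hA4, hA3, hA2, hA1, place_inj, hi']
  · simp [hA4, hA3, hA2, hA1, (place_ne_zero _ _).symm]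
  · simp [hA4, hA3, hA2, hA1, (place_ne_one _ _).symm]
  -- The four cells written are different, so each changes only once and the intermediate arrays
  -- contain nothing but old and new values. This keeps spurious `1`s out of the limsup.
  · have d1 : place i (4 * h) ≠ place i (4 * h + 1) := by simp [place_inj]
    have d2 : place i (4 * h) ≠ place i (4 * h + 2) := by simp [place_inj]
    have d3 : place i (4 * h) ≠ place i 3 := by rw [ne_eq, place_inj]; omega
    have d4 : place i (4 * h + 1) ≠ place i (4 * h + 2) := by simp [place_inj]
    have d5 : place i (4 * h + 1) ≠ place i 3 := by rw [ne_eq, place_inj]; omega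
    have d6 : place i (4 * h + 2) ≠ place i 3 := by rw [ne_eq, place_inj]; omega
    have e3 : ∀ u, A3 u = A u ∨ A3 u = A4 u := fun u => by
      by_cases h0 : u = place i 3
      · left; rw [h0, hA33]
      · right; rw [hA4, Function.update_of_ne h0]
    have e2 : ∀ u, A2 u = A u ∨ A2 u = A4 u := fun u => by
      by_cases h0 : u = place i (4 * h + 2)
      · left; rw [h0, hA2, Function.update_of_ne d4.symm, hA1, Function.update_of_ne d2.symm]
      · rw [← Function.update_of_ne h0 _ A2]; exact e3 u
    have e1 : ∀ u, A1 u = A u ∨ A1 u = A4 u := fun u => by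
      by_cases h0 : u = place i (4 * h + 1)
      · left; rw [h0, hA1, Function.update_of_ne d1.symm]
      · rw [← Function.update_of_ne h0 _ A1]; exact e2 u
    intro j hj u
    interval_cases j
    · exact Or.inl rfl
    · exact Or.inl (by rw [s1])
    · exact Or.inl (by rw [s2])
    · exact Or.inl (by rw [s3])
    · rw [s4]; exact e1 u
    · rw [s5]; exact e2 u
    · rw [s6]; exact e3 u

/-- The present program enters the state `2` in the next step, for the first time. -/
def Halts (i : ℕ) (c : CodeConfig) : Prop := c.2 3 = false ∧ c.entry i / 24 = 2

instance (i : ℕ) (c : CodeConfig) : Decidable (Halts i c) := inferInstanceAs (Decidable (_ ∧ _))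

/-- It takes five steps to check whether a program halts. -/
theorem check_step (n : ℕ) (f : Bool) (A : ℕ → Bool) :
    universal.step^[5] ((1, n, [], f, []), A) =
      (if Halts n.unpair.1 (present n f [] A) then (6, n, [], f, []) else (1, n + 1, [], f, []), A) ∧
    ∀ j < 5, (universal.step^[j] ((1, n, [], f, []), A)).2 = A := by
  have s1 := step_one (n := n) (bits := []) (f := f) (L := []) (A := A)
  have hs := fun j => Function.iterate_succ_apply' universal.step j ((1, n, [], f, []), A)
  have s2 := (hs 1).trans ((congrArg _ s1).trans (step_read_zero (Or.inl rfl)))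
  have s3 := (hs 2).trans ((congrArg _ s2).trans (step_read_one (Or.inl rfl)))
  have s4 := (hs 3).trans ((congrArg _ s3).trans (step_read_two (Or.inl rfl)))
  refine ⟨?_, fun j hj => ?_⟩
  · rw [hs 4, s4, step_decide]
    rfl
  · interval_cases j
    · rfl
    · rw [Function.iterate_one, s1]
    · rw [s2]
    · rw [s3]
    · rw [s4]

end UState

end InfiniteTime

/-! ### One block of the universal machine. -/

namespace InfiniteTime

open Filter
open scoped Ordinal

namespace UState

/-- The configuration of the program `i` at the beginning of a block with the array `B`. -/
def start (B : ℕ → Bool) (i : ℕ) : CodeConfig := ((if B 1 = true then 0 else 1, 0), row B i)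

theorem present_update (n : ℕ) (B : ℕ → Bool) :
    present n (B 1) [] (Function.update B 0 true) = start B n.unpair.1 := by
  refine Prod.ext rfl ?_
  funext k
  simp [present, start, row, place_ne_zero]

/-- One step reads the cell `1`, and each unsuccessful candidate costs five; the search only reads.
-/
theorem iterate_check (B : ℕ → Bool) (n : ℕ)
    (h : ∀ n' < n, ¬Halts n'.unpair.1 (start B n'.unpair.1)) :
    universal.step^[1 + 5 * n] (universal.init, Function.update B 0 true) =
      ((1, n, [], B 1, []), Function.update B 0 true) ∧
    ∀ j < 1 + 5 * n, (universal.step^[j] (universal.init, Function.update B 0 true)).2 =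
      Function.update B 0 true := by
  induction n with
  | zero =>
    refine ⟨(step_init ..).trans (by simp), fun j hj => ?_⟩
    obtain rfl : j = 0 := by omega
    rfl
  | succ n ih =>
    obtain ⟨h1, h2⟩ := ih fun n' hn' => h n' (by omega)
    obtain ⟨h3, h4⟩ := check_step n (B 1) (Function.update B 0 true)
    rw [present_update, if_neg (h n (by omega))] at h3
    refine ⟨?_, fun j hj => ?_⟩
    · rw [show 1 + 5 * (n + 1) = 5 + (1 + 5 * n) by ring, Function.iterate_add_apply, h1, h3]
    · by_cases hjn : j < 1 + 5 * n
      · exact h2 j hjn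
      · obtain ⟨d, rfl⟩ := Nat.exists_eq_add_of_le (not_lt.1 hjn)
        rw [add_comm, Function.iterate_add_apply, h1]
        exact h4 d (by omega)

/-- If no program halts, then the first bit remains `1`. -/
theorem block_of_not_halts {B : ℕ → Bool} (h : ∀ i, ¬Halts i (start B i)) (m : ℕ) :
    universal.block B m 0 = true := by
  rw [Ctl.block, (iterate_check B m fun n' _ => h _).2 m (by omega)]
  simp

/-- If some program halts, then the simulation is started. -/
theorem exists_iterate_run {B : ℕ → Bool} (h : ∃ i, Halts i (start B i)) :
    ∃ N, 0 < N ∧ universal.step^[N] (universal.init, Function.update B 0 true) =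
      ((8, 0, [], B 1, []), Function.update (Function.update B 0 false) 1 true) ∧
    ∀ j < N, ∀ u, u ≠ 0 →
      (universal.step^[j] (universal.init, Function.update B 0 true)).2 u = B u := by
  classical
  have hex : ∃ n : ℕ, Halts n.unpair.1 (start B n.unpair.1) := by
    obtain ⟨i, hi⟩ := h
    exact ⟨Nat.pair i 0, by simpa using hi⟩
  obtain ⟨h1, h2⟩ := iterate_check B (Nat.find hex) fun n' hn' => Nat.find_min hex hn'
  generalize hn : Nat.find hex = n at h1 h2
  have hn1 : Halts n.unpair.1 (start B n.unpair.1) := hn ▸ Nat.find_spec hex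
  obtain ⟨h3, h4⟩ := check_step n (B 1) (Function.update B 0 true)
  rw [present_update, if_pos hn1, ← h1, ← Function.iterate_add_apply] at h3
  have h5 := (Function.iterate_succ_apply' universal.step _ _).trans
    ((congrArg _ h3).trans step_six)
  have h6 := (Function.iterate_succ_apply' universal.step _ _).trans
    ((congrArg _ h5).trans step_seven)
  refine ⟨_, Nat.succ_pos _, h6.trans (by simp), fun j hj u hu => ?_⟩
  by_cases hjn : j < 1 + 5 * n
  · rw [h2 j hjn]; simp [hu]
  obtain ⟨d, rfl⟩ := Nat.exists_eq_add_of_le (not_lt.1 hjn)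
  by_cases hd : d < 5
  · rw [add_comm, Function.iterate_add_apply, h1, h4 d hd]; simp [hu]
  obtain rfl | rfl : d = 5 ∨ d = 6 := by omega
  · rw [add_comm, h3]; simp [hu]
  · rw [show 1 + 5 * n + 6 = (5 + (1 + 5 * n)).succ by omega, h5]; simp [hu]

/-- How often the program `i` is simulated in the first `n` rounds. -/
def rounds (i n : ℕ) : ℕ := Nat.count (fun m => m.unpair.1 = i) n

/-- Each `i` is the first component of infinitely many numbers, so `Nat.nth` gives the round before
which `i` had exactly `s` turns. -/
theorem exists_rounds_eq (i s : ℕ) : ∃ n, s ≤ n ∧ rounds i n = s := by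
  have hinf : {m : ℕ | m.unpair.1 = i}.Infinite := by
    refine Set.infinite_of_injective_forall_mem (f := fun k => Nat.pair i k) ?_ ?_
    · intro a b hab
      exact (Nat.pair_eq_pair.1 hab).2
    · exact fun k => congrArg Prod.fst (Nat.unpair_pair i k)
  have h := Nat.count_nth_of_infinite hinf s
  exact ⟨_, h.ge.trans (Nat.count_le _), h⟩

theorem tendsto_rounds (i : ℕ) : Tendsto (rounds i) atTop atTop := by
  refine tendsto_atTop_atTop_of_monotone (Nat.count_monotone _) fun s => ?_
  obtain ⟨n, -, hn⟩ := exists_rounds_eq i s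
  exact ⟨n, hn.ge⟩

/-- The universal machine simulates all programs. -/
theorem block_of_halts {B : ℕ → Bool} (h : ∃ i, Halts i (start B i)) :
    (∀ᶠ m in atTop, universal.block B m 0 = false ∧ universal.block B m 1 = true) ∧
    ∀ i k, (∀ m, ∃ s, universal.block B m (place i k) = ((codeStep i)^[s] (start B i)).2 k) ∧
      (∀ S, ∀ᶠ m in atTop, ∃ s ≥ S,
        universal.block B m (place i k) = ((codeStep i)^[s] (start B i)).2 k) ∧
      ∀ s, ∃ m ≥ s, universal.block B m (place i k) = ((codeStep i)^[s] (start B i)).2 k := by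
  obtain ⟨N, hN0, hN, hNB⟩ := exists_iterate_run h
  set A₁ := Function.update (Function.update B 0 false) 1 true with hA₁
  have inv : ∀ n, ∃ L A, universal.step^[7 * n] ((8, 0, [], B 1, []), A₁) =
      ((8, n, [], B 1, L), A) ∧ A 0 = false ∧ A 1 = true ∧
      ∀ i, (lookup (B 1) L i, row A i) = (codeStep i)^[rounds i n] (start B i) := by
    intro n
    induction n with
    | zero =>
      refine ⟨[], A₁, rfl, by simp [hA₁], by simp [hA₁], fun i => Prod.ext rfl ?_⟩
      funext k
      simp [row, hA₁, place_ne_zero, place_ne_one, start, rounds]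
    | succ n ih =>
      obtain ⟨L, A, h1, h2, h3, h4⟩ := ih
      obtain ⟨A', g1, g2, g3, g4, g5, -⟩ := run_step n (B 1) L A
      refine ⟨(n.unpair.1, (codeStep n.unpair.1 (present n (B 1) L A)).1) :: L, A', ?_, g4.trans h2, g5.trans h3, fun i => ?_⟩
      · rw [show 7 * (n + 1) = 7 + 7 * n by ring, Function.iterate_add_apply, h1, g1]
      · rw [lookup_cons]
        by_cases hi : n.unpair.1 = i
        · rw [show rounds i (n + 1) = rounds i n + 1 by simp [rounds, Nat.count_succ, hi],
            Function.iterate_succ_apply', ← h4 i, if_pos hi]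
          subst hi
          rw [g2]
          rfl
        · rw [show rounds i (n + 1) = rounds i n by simp [rounds, Nat.count_succ, hi],
            ← h4 i, if_neg hi, g3 i (Ne.symm hi)]
  choose L A hLA hA0 hA1 hrow using inv
  let C : ℕ → UState × (ℕ → Bool) := fun n => Nat.casesOn n
    (universal.init, Function.update B 0 true) fun n => ((8, n, [], B 1, L n), A n)
  -- Link `0` is the search, which leaves all cells but the flag as in `B`; link `n + 1` is round
  -- `n` of the simulation.
  let S : ℕ → UState × (ℕ → Bool) → Prop := fun n x => Nat.casesOn n
    (∀ u, u ≠ 0 → x.2 u = B u) fun n => ∀ u, x.2 u = A n u ∨ x.2 u = A (n + 1) u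
  have hCS : ∀ n, ∃ k, 0 < k ∧ universal.step^[k] (C n) = C (n + 1) ∧
      ∀ j < k, S n (universal.step^[j] (C n)) := by
    intro n
    cases n with
    | zero => exact ⟨N, hN0, hN.trans (hLA 0), hNB⟩
    | succ n =>
      obtain ⟨A', g1, -, -, -, -, g2⟩ := run_step n (B 1) (L n) (A n)
      have h1 : universal.step^[7] ((8, n, [], B 1, L n), A n) =
          ((8, n + 1, [], B 1, L (n + 1)), A (n + 1)) := by
        rw [← hLA n, ← Function.iterate_add_apply, show 7 + 7 * n = 7 * (n + 1) by ring, hLA]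
      obtain rfl : A' = A (n + 1) := congrArg Prod.snd (g1.symm.trans h1)
      exact ⟨7, by norm_num, h1, g2⟩
  obtain ⟨ρ, θ, hρ, hS, hθ, hθC⟩ := exists_times hCS
  have hS : ∀ m, S (ρ m) (universal.step^[m] (universal.init, Function.update B 0 true)) := hS
  refine ⟨?_, fun i k => ?_⟩
  · filter_upwards [hρ.eventually_gt_atTop 0] with m hm
    have h1 := hS m
    obtain ⟨n, hn⟩ := Nat.exists_eq_succ_of_ne_zero hm.ne'
    rw [hn] at h1
    refine ⟨?_, ?_⟩
    · rcases h1 0 with h1 | h1 <;> exact h1.trans (hA0 _)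
    · rcases h1 1 with h1 | h1 <;> exact h1.trans (hA1 _)
  · have hw : ∀ n, A n (place i k) = ((codeStep i)^[rounds i n] (start B i)).2 k := fun n =>
      congrFun (congrArg Prod.snd (hrow n i)) k
    -- During the search the memory of `i` is that after `0` steps; during round `ρ m - 1` each of
    -- its cells is as before or after that round.
    have hval : ∀ m, ∃ s ≥ rounds i (ρ m - 1),
        universal.block B m (place i k) = ((codeStep i)^[s] (start B i)).2 k := by
      intro m
      have h1 := hS m
      rcases hn : ρ m with _ | n
      · rw [hn] at h1
        exact ⟨0, by simp [rounds], h1 _ (place_ne_zero i k)⟩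
      · rw [hn] at h1
        rcases h1 (place i k) with h1 | h1
        · exact ⟨_, le_rfl, h1.trans (hw n)⟩
        · exact ⟨_, Nat.count_monotone _ (Nat.le_succ n), h1.trans (hw (n + 1))⟩
    refine ⟨fun m => ?_, fun s₀ => ?_, fun s => ?_⟩
    · obtain ⟨s, -, hs⟩ := hval m
      exact ⟨s, hs⟩
    · have ht := (tendsto_rounds i).comp ((tendsto_sub_atTop_nat 1).comp hρ)
      filter_upwards [ht.eventually_ge_atTop s₀] with m hm
      obtain ⟨s, hs1, hs2⟩ := hval m
      exact ⟨s, le_trans hm hs1, hs2⟩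
    · obtain ⟨n, hn1, hn2⟩ := exists_rounds_eq i s
      refine ⟨θ (n + 1), hn1.trans ((Nat.le_succ n).trans (hθ _)), ?_⟩
      have h1 := hw n
      rw [hn2] at h1
      rw [← h1]
      exact congrFun (congrArg Prod.snd (hθC (n + 1))) _

end UState

end InfiniteTime

/-! ### Codes of programs, their halting stages and the gap. -/

namespace InfiniteTime

open Filter
open scoped Ordinal

/-- Finite tables can be given by lists. -/
theorem exists_list_getD {α : Type*} [Finite α] {key : α → ℕ} (hkey : Function.Injective key)
    (g : α → ℕ) : ∃ l : List ℕ, ∀ x, l.getD (key x) 0 = g x := by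
  obtain ⟨N, hN⟩ := (Set.finite_range key).bddAbove
  refine ⟨(List.range (N + 1)).map (Function.extend key g 0), fun x => ?_⟩
  have hx : key x < N + 1 := Nat.lt_succ_of_le (hN ⟨x, rfl⟩)
  rw [List.getD_eq_getElem _ _ (by simpa using hx)]
  simp [hkey.extend_apply]

/-- The movement of the head as a number. -/
def Move.code : Move → ℕ
  | .left => 0
  | .stay => 1
  | .right => 2

/-- Truncated subtraction is just the rule for the left-most cell. -/
theorem Move.apply_eq (m : Move) (h : ℕ) : m.apply h = h + m.code - 1 := by
  cases m <;> simp [Move.apply, Move.code]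

theorem Move.code_lt (m : Move) : m.code < 3 := by
  cases m <;> simp [Move.code]

/-- An action as a number. -/
def Action.code {Q : Type} (e : Q → ℕ) (a : Action Q) : ℕ :=
  (a.write .input).toNat + 2 * (a.write .scratch).toNat + 4 * (a.write .output).toNat +
    8 * a.move.code + 24 * e a.next

/-- Each program has a code. -/
theorem Program.exists_code (p : Program) : ∃ (i : ℕ) (e : p.State → ℕ), e p.limit = 0 ∧
    e p.start = 1 ∧ (∀ q, e q = 2 ↔ q = p.halt) ∧
    ∀ q (c : Column), entry i (e q) (c .input) (c .scratch) (c .output) =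
      (p.instr q c).code e := by
  classical
  have := p.finite_state
  obtain ⟨f, hf⟩ := exists_injective_nat p.State
  let e : p.State → ℕ := fun q => if q = p.limit then 0 else if q = p.start then 1 else
    if q = p.halt then 2 else f q + 3
  have h1 := p.start_ne_limit
  have h2 := p.start_ne_halt
  have h3 := p.limit_ne_halt
  have he : Function.Injective e := by
    intro a b hab
    simp only [e] at hab
    split_ifs at hab <;> first | (subst_vars; rfl) | omega | exact hf (by omega)
  have hh : e p.halt = 2 := by simp [e, h2.symm, h3.symm]
  let col : Bool × Bool × Bool → Column := fun b t => match t with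
    | .input => b.1
    | .scratch => b.2.1
    | .output => b.2.2
  have hkey : Function.Injective fun x : p.State × Bool × Bool × Bool =>
      8 * e x.1 + 4 * x.2.1.toNat + 2 * x.2.2.1.toNat + x.2.2.2.toNat := by
    rintro ⟨q, a, b, c⟩ ⟨q', a', b', c'⟩ h
    have hq : e q = e q' := by
      cases a <;> cases b <;> cases c <;> cases a' <;> cases b' <;> cases c' <;>
        simp at h <;> omega
    obtain rfl := he hq
    cases a <;> cases b <;> cases c <;> cases a' <;> cases b' <;> cases c' <;>
      simp at h <;> first | rfl | omega
  obtain ⟨l, hl⟩ := exists_list_getD hkey fun x => (p.instr x.1 (col x.2)).code e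
  refine ⟨Encodable.encode l, e, by simp [e], by simp [e, h1], fun q => ⟨fun h => ?_, ?_⟩,
    fun q c => ?_⟩
  · exact he (h.trans hh.symm)
  · rintro rfl; exact hh
  · have hc : col (c .input, c .scratch, c .output) = c := by
      funext t
      cases t <;> rfl
    have := hl (q, c .input, c .scratch, c .output)
    simp only [hc] at this
    simpa [entry] using this

theorem Action.code_mod {Q : Type} (e : Q → ℕ) (a : Action Q) :
    decide (a.code e % 2 = 1) = a.write .input ∧ decide (a.code e / 2 % 2 = 1) = a.write .scratch ∧
    decide (a.code e / 4 % 2 = 1) = a.write .output ∧ a.code e / 8 % 3 = a.move.code ∧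
    a.code e / 24 = e a.next := by
  have hm := a.move.code_lt
  rcases h0 : a.write .input <;> rcases h1 : a.write .scratch <;> rcases h2 : a.write .output <;>
    simp only [Action.code, h0, h1, h2, Bool.toNat_true, Bool.toNat_false, decide_eq_true_eq,
      decide_eq_false_iff_not] <;> omega

/-- The computation of a code agrees with the computation of the program. -/
theorem codeRun_eq_run {p : Program} {i : ℕ} {e : p.State → ℕ} (hlim : e p.limit = 0)
    (hst : e p.start = 1) (hhalt : ∀ q, e q = 2 ↔ q = p.halt)
    (hcode : ∀ q (c : Column), entry i (e q) (c .input) (c .scratch) (c .output) =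
      (p.instr q c).code e) (α : Ordinal.{0}) :
    (codeRun i α).1 = (e (p.run zeroReal α).state, (p.run zeroReal α).head) ∧
    (∀ n, (codeRun i α).2 (4 * n) = (p.run zeroReal α).cell .input n) ∧
    (∀ n, (codeRun i α).2 (4 * n + 1) = (p.run zeroReal α).cell .scratch n) ∧
    (∀ n, (codeRun i α).2 (4 * n + 2) = (p.run zeroReal α).cell .output n) ∧
    ((codeRun i α).2 3 = true ↔ ∃ β < α, (p.run zeroReal (β + 1)).state = p.halt) := by
  induction α using Ordinal.limitRecOn with
  | zero =>
    rw [codeRun_zero, p.run_zero]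
    exact ⟨by rw [← hst]; rfl, fun _ => rfl, fun _ => rfl, fun _ => rfl, by simp⟩
  | add_one α ih =>
    obtain ⟨g1, g2, g3, g4, g5⟩ := ih
    set c := p.run zeroReal α with hc
    have hen : CodeConfig.entry i (codeRun i α) = (p.action c).code e := by
      rw [CodeConfig.entry, g1, g2, g3, g4]
      exact hcode c.state fun t => c.cell t c.head
    obtain ⟨a1, a2, a3, a4, a5⟩ := (p.action c).code_mod e
    have hmem : (codeRun i (α + 1)).2 =
        writeEntry ((p.action c).code e) c.head (codeRun i α).2 := by
      rw [codeRun_add_one, codeStep, hen, g1]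
    have hrun : p.run zeroReal (α + 1) = p.step c := p.run_add_one zeroReal α
    refine ⟨?_, fun n => ?_, fun n => ?_, fun n => ?_, ?_⟩
    · rw [codeRun_add_one, codeStep, hen, g1, hrun, a4, a5, ← Move.apply_eq]
      rfl
    · rw [hmem, hrun, ← show _ = (p.step c).cell .input n from rfl]
      simp only [writeEntry, a1, a2, a3, Program.step, Function.update_apply]
      rw [if_neg (by omega), if_neg (by omega), if_neg (by omega), g2]
      by_cases h : n = c.head
      · rw [if_pos (by omega), if_pos h]
      · rw [if_neg (by omega), if_neg h]
    · rw [hmem, hrun]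
      simp only [writeEntry, a1, a2, a3, Program.step, Function.update_apply]
      rw [if_neg (by omega), if_neg (by omega)]
      by_cases h : n = c.head
      · rw [if_pos (by omega), if_pos h]
      · rw [if_neg (by omega), if_neg (by omega), if_neg h, g3]
    · rw [hmem, hrun]
      simp only [writeEntry, a1, a2, a3, Program.step, Function.update_apply]
      rw [if_neg (by omega)]
      by_cases h : n = c.head
      · rw [if_pos (by omega), if_pos h]
      · rw [if_neg (by omega), if_neg (by omega), if_neg (by omega), if_neg h, g4]
    · have h3 : (codeRun i (α + 1)).2 3 =
          if (p.action c).code e / 24 = 2 then true else (codeRun i α).2 3 := by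
        rw [hmem, writeEntry, Function.update_self]
      rw [h3, a5]
      have hs : (p.run zeroReal (α + 1)).state = (p.action c).next := by rw [hrun]; rfl
      constructor
      · intro h
        split_ifs at h with h'
        · exact ⟨α, lt_add_one α, hs.trans ((hhalt _).1 h')⟩
        · obtain ⟨β, hβ, hβ2⟩ := g5.1 h
          exact ⟨β, hβ.trans (lt_add_one α), hβ2⟩
      · rintro ⟨β, hβ, hβ2⟩
        rcases (Order.lt_add_one_iff.1 hβ).eq_or_lt with rfl | h
        · rw [if_pos ((hhalt _).2 (hs.symm.trans hβ2))]
        · rw [g5.2 ⟨β, h, hβ2⟩, ite_self]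
  | limit l hl ih =>
    refine ⟨?_, fun n => ?_, fun n => ?_, fun n => ?_, ?_⟩
    · rw [codeRun_limit_fst i hl, p.run_limit_state _ hl, p.run_limit_head _ hl, hlim]
    iterate 3
      rw [Bool.eq_iff_iff, codeRun_limit_snd i hl, p.run_limit_cell _ hl]
      refine forall₂_congr fun β _ => exists_congr fun γ => and_congr_right fun hγ => ?_
      simp [ih γ hγ]
    · rw [codeRun_limit_snd i hl]
      constructor
      · intro h
        obtain ⟨γ, h1, -, h2⟩ := h 0 hl.bot_lt
        obtain ⟨β, h3, h4⟩ := (ih γ h1).2.2.2.2.1 h2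
        exact ⟨β, h3.trans h1, h4⟩
      -- The mark is set from stage `β + 1` on, hence at unboundedly many stages below `l`.
      · rintro ⟨β, h1, h2⟩ β' h3
        have h4 : β + 1 < l := by
          have := hl.succ_lt h1
          rwa [Order.succ_eq_add_one] at this
        have h5 := max_lt h3 h4
        exact ⟨_, h5, le_max_left _ _, (ih _ h5).2.2.2.2.2
          ⟨β, (lt_add_one β).trans_le (le_max_right _ _), h2⟩⟩

open UState (Halts)

/-- If a program takes exactly `α` many steps, then its code enters the state `2` after the stage
`α`, for the first time. -/
theorem exists_halts_of_clockable {α : Ordinal.{0}} (h : Clockable α) :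
    ∃ i, Halts i (codeRun i α) := by
  obtain ⟨p, h1, h2⟩ := h
  obtain ⟨i, e, e1, e2, e3, e4⟩ := p.exists_code
  have H := codeRun_eq_run e1 e2 e3 e4
  refine ⟨i, ?_, ?_⟩
  · rw [← Bool.not_eq_true, (H α).2.2.2.2]
    rintro ⟨β, hβ, hβ2⟩
    exact h1 _ (Order.add_one_le_of_lt hβ) hβ2
  · have h3 := (H (α + 1)).1
    rw [codeRun_add_one, h2, (e3 p.halt).2 rfl] at h3
    exact congrArg Prod.fst h3

theorem codeRun_three_of_le (i : ℕ) {α β : Ordinal.{0}} (h : α ≤ β)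
    (hα : (codeRun i α).2 3 = true) : (codeRun i β).2 3 = true := by
  induction β using Ordinal.limitRecOn with
  | zero => rwa [nonpos_iff_eq_zero.1 h] at hα
  | add_one β ih =>
    rcases h.eq_or_lt with rfl | h
    · exact hα
    · rw [codeRun_add_one]
      simp [codeStep, writeEntry, ih (Order.lt_add_one_iff.1 h)]
  | limit l hl ih =>
    rcases h.eq_or_lt with rfl | h
    · exact hα
    · rw [codeRun_limit_snd i hl]
      intro β hβ
      exact ⟨_, max_lt hβ h, le_max_left _ _, ih _ (max_lt hβ h) (le_max_right _ _)⟩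

/-- A coded run goes on after the state `2` and may enter it again. The mark at the index `3`, which
is never erased, singles out the first time. -/
theorem Halts.eq {i : ℕ} {α β : Ordinal.{0}} (hα : Halts i (codeRun i α))
    (hβ : Halts i (codeRun i β)) : α = β := by
  have key : ∀ α β : Ordinal.{0}, Halts i (codeRun i α) → Halts i (codeRun i β) → ¬α < β := by
    intro α β hα hβ h
    have h1 : (codeRun i (α + 1)).2 3 = true := by
      rw [codeRun_add_one]
      simp [codeStep, writeEntry, hα.2]
    have h2 := codeRun_three_of_le i (Order.add_one_le_of_lt h) h1
    rw [hβ.1] at h2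
    exact Bool.noConfusion h2
  exact le_antisymm (not_lt.1 (key β α hβ hα)) (not_lt.1 (key α β hα hβ))

/-- At some multiple of `ω` no program halts. -/
theorem exists_forall_not_halts : ∃ α : Ordinal.{0}, ∀ i, ¬Halts i (codeRun i (ω * α)) := by
  by_contra! h
  choose f hf using h
  -- A choice of a halting code for each multiple of `ω` would embed the ordinals into `ℕ`.
  refine not_injective_of_ordinal f fun α β hαβ => ?_
  have h1 := hf α
  rw [hαβ] at h1
  exact mul_left_cancel₀ Ordinal.omega0_ne_zero (Halts.eq h1 (hf β))

open Classical in
/-- The array at the stage `ω * α` of the simulation. -/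
noncomputable def stageArray (α : Ordinal.{0}) (v : ℕ) : Bool :=
  if v = 0 then false else if v = 1 then decide (α ≠ 0) else
    (codeRun (v - 2).unpair.1 (ω * α)).2 (v - 2).unpair.2

theorem stageArray_place (α : Ordinal.{0}) (i k : ℕ) :
    stageArray α (UState.place i k) = (codeRun i (ω * α)).2 k := by
  simp [stageArray, UState.place]

/-- The first block begins in the start state `1` and all others in the limit state `0`; the cell
`1` of the array carries this distinction. -/
theorem start_stageArray (α : Ordinal.{0}) (i : ℕ) :
    UState.start (stageArray α) i = codeRun i (ω * α) := by
  refine Prod.ext ?_ (funext fun k => stageArray_place α i k)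
  by_cases hα : α = 0
  · subst hα
    simp [UState.start, stageArray, codeRun_zero]
  · rw [codeRun_limit_fst i (Ordinal.isSuccLimit_mul_left Ordinal.isSuccLimit_omega0
      (pos_iff_ne_zero.2 hα))]
    simp [UState.start, stageArray, hα]

theorem exists_eq_place {v : ℕ} (h0 : v ≠ 0) (h1 : v ≠ 1) : ∃ i k, v = UState.place i k :=
  ⟨(v - 2).unpair.1, (v - 2).unpair.2, by rw [UState.place, Nat.pair_unpair]; omega⟩

/-- The universal machine reaches a stage beyond the first multiple of `ω` at which no program
halts. -/
theorem exists_clockable_gt {α₀ : Ordinal.{0}} (h0 : ∀ i, ¬Halts i (codeRun i (ω * α₀)))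
    (hlt : ∀ α < α₀, ∃ i, Halts i (codeRun i (ω * α))) :
    ∃ β, ω * α₀ < β ∧ Clockable β := by
  simp only [← start_stageArray] at h0 hlt
  have hb := fun α (h : α < α₀) => UState.block_of_halts (hlt α h)
  simp only [start_stageArray, ← codeRun_add_nat] at hb
  refine universal.exists_clockable stageArray α₀ (fun v => ?_) (fun α hα v hv => ?_)
    (fun l hl hlim v hv => ?_) (fun α hα => ?_) ?_
  · simp [stageArray, codeRun_zero]
  · obtain ⟨b1, b2⟩ := hb α hα
    by_cases h1 : v = 1
    · subst h1
      refine iff_of_true (by simp [stageArray]) (Eventually.frequently ?_)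
      exact b1.mono fun m hm => hm.2
    · obtain ⟨i, k, rfl⟩ := exists_eq_place hv h1
      obtain ⟨-, b3, b4⟩ := b2 i k
      rw [stageArray_place, mul_add_one, codeRun_limit_snd i
        (Ordinal.isSuccLimit_add _ Ordinal.isSuccLimit_omega0), unboundedBelow_add_omega0,
        frequently_atTop, frequently_atTop]
      constructor
      · intro H N
        obtain ⟨s, hs, hs2⟩ := H N
        obtain ⟨m, hm, hm2⟩ := b4 s
        exact ⟨m, hs.trans hm, hm2.trans hs2⟩
      · intro H N
        obtain ⟨T, hT⟩ := eventually_atTop.1 (b3 N)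
        obtain ⟨m, hm, hm2⟩ := H T
        obtain ⟨s, hs, hs2⟩ := hT m hm
        exact ⟨s, hs, hs2.symm.trans hm2⟩
  · by_cases h1 : v = 1
    · subst h1
      refine iff_of_true (by simpa [stageArray] using hlim.ne_bot) fun α hα => ?_
      obtain ⟨m, -, hm⟩ := (hb α (hα.trans_le hl)).1.exists
      exact ⟨α, hα, le_rfl, m, hm⟩
    · obtain ⟨i, k, rfl⟩ := exists_eq_place hv h1
      rw [stageArray_place, codeRun_limit_snd i
        (Ordinal.isSuccLimit_mul_right Ordinal.omega0_pos hlim),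
        unboundedBelow_mul Ordinal.omega0_ne_zero hlim]
      refine forall₂_congr fun α _ => exists_congr fun α' => and_congr_right fun hα' =>
        and_congr_right fun _ => ?_
      obtain ⟨b2, -, b4⟩ := (hb α' (hα'.trans_le hl)).2 i k
      constructor
      · rintro ⟨δ, hδ, h⟩
        obtain ⟨s, rfl⟩ := Ordinal.lt_omega0.1 hδ
        obtain ⟨m, -, hm⟩ := b4 s
        exact ⟨m, hm.trans h⟩
      · rintro ⟨m, hm⟩
        obtain ⟨s, hs⟩ := b2 m
        exact ⟨s, Ordinal.natCast_lt_omega0 s, hs.symm.trans hm⟩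
  · rw [not_frequently]
    exact (hb α hα).1.mono fun m hm => by simp [hm.1]
  -- At `α₀` the search never ends, so the flag stays up during the whole main phase.
  · exact (Eventually.of_forall fun m => UState.block_of_not_halts h0 m).frequently

end InfiniteTime

theorem mainTheorem4 :
    ∃ α β : Ordinal.{0}, α < β ∧ InfiniteTime.Clockable β ∧ ¬ InfiniteTime.Clockable α := by
  classical
  let S : Set Ordinal.{0} :=
    {α | ∀ i, ¬InfiniteTime.UState.Halts i (InfiniteTime.codeRun i (Ordinal.omega0 * α))}
  have hS : S.Nonempty := InfiniteTime.exists_forall_not_halts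
  have h0 := WellFounded.min_mem Ordinal.lt_wf S hS
  obtain ⟨β, hβ, hβ2⟩ := InfiniteTime.exists_clockable_gt h0 fun α hα => by
    by_contra! h
    exact Ordinal.lt_wf.not_lt_min S h hα
  refine ⟨_, β, hβ, hβ2, fun h => ?_⟩
  obtain ⟨i, hi⟩ := InfiniteTime.exists_halts_of_clockable h
  exact h0 i hi
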